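/- \textbf{Setting.} Types are built from elementary types (finite-dimensional quantum systems, tensor products $AB$ of such, and the trivial one-dimensional system $I$) by forming $(x\to y)$, and are regarded as words in elementary types, brackets and arrows. Let $\mathsf{Ele}_x$ be the set of non-trivial elementary systems (dimension at least $2$) occurring in $x$; each of them is assumed to occur only once in $x$ (copies of a system get different names). For a word $w$ in which $A$ occurs let $K_w(A)\in\{0,1\}$ be the number of arrows plus the number of open brackets to the right of $A$ in $w$, modulo $2$; put $\mathsf{in}_x=\{A\in\mathsf{Ele}_x: K_x(A)=1\}$ and $\mathsf{out}_x=\mathsf{Ele}_x\setminus\mathsf{in}_x$. Write $y\prec x$ if $y$ is a proper subtype of $x$ (the transitive closure of the relation "$x=y\to z$ or $x=z\to y$ for some $z$"), and $y\preceq x$ if $y\prec x$ or $y=x$. The type extension is $A\|E:=AE$, $(x\to y)\|E:=x\to(y\|E)$. Maps of type $x$ are operators on $\mathcal H_x=\bigotimes_{A\in\mathsf{Ele}_x}\mathcal H_A$; an operator $M$ of type $x\to y$ is the Choi operator of a linear map $\mathcal M:\mathcal L(\mathcal H_x)\to\mathcal L(\mathcal H_y)$. For an elementary type, the deterministic maps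 are the density operators, and the admissible maps are the $M\ge 0$ with $M\le N$ for a density operator $N$. An operator $M$ of type $x\to y$ is admissible if (i) for every elementary type $E$, $\mathcal M\otimes\mathcal I_E$ sends admissible maps of type $x\|E$ to admissible maps of type $y\|E$, and (ii) there are finitely many (possibly zero) $N_i$ of type $x\to y$ satisfying (i) such that, for every $E$, $(\mathcal M+\sum_i\mathcal N_i)\otimes\mathcal I_E$ sends deterministic maps of type $x\|E$ to deterministic maps of type $y\|E$. It is deterministic if it is admissible and, for every $E$, $\mathcal M\otimes\mathcal I_E$ sends deterministic maps of type $x\|E$ to deterministic maps of type $y\|E$. For $A\in\mathsf{in}_x$ and $B\in\mathsf{out}_x$ the type $x$ is \emph{no-signalling} from $A$ to $B$ ($A\not\rightsquigarrow_x B$) if every deterministic map $R$ of type $x$ satisfies $\operatorname{Tr}_{\mathsf{out}_x\setminus\{B\}}R=I_A\otimes R'$ for some operator $R'$; otherwise it is \emph{signalling} from $A$ to $B$. It is \emph{full-signalling} from $A$ to $B$ if the type $\overline x:=x\to I$ is no-signalling from $B$ to $A$. \textbf{Proposition.} Let $x$ be a type, $A\in\mathsf{in}_x$ and $B\in\mathsf{out}_x$.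 (1) There is a unique type $y\preceq x$ such that $\{A,B\}\subseteq\mathsf{Ele}_y$ and $\{A,B\}\not\subseteq\mathsf{Ele}_{y'}$ for all $y'\prec y$. It satisfies $y\preceq y'$ for every $y'\preceq x$ with $\{A,B\}\subseteq\mathsf{Ele}_{y'}$, and it has the form $y=y_1\to y_2$ with one of $A,B$ occurring in $y_1$ and the other in $y_2$. (2) If $A\in\mathsf{in}_y$, then $x$ is full-signalling, and in particular signalling, from $A$ to $B$. If $A\in\mathsf{out}_y$, then $x$ is no-signalling from $A$ to $B$. (3) There is exactly one smallest substring $s$ of the word $x$ which contains $A$ and $B$ and has balanced brackets; it is the word $y$ without its outer brackets, and $x$ is signalling from $A$ to $B$ if and only if $K_s(A)=K_x(A)$. (4) There is a polynomial-time algorithm (a multi-stack Turing machine, with systems named by binary numbers) which, given the word of a type $x$, an $A\in\mathsf{in}_x$ and a $B\in\mathsf{out}_x$, decides whether $x$ is signalling from $A$ to $B$. The algorithm does not depend on the dimensions of the systems. -/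

import Mathlib

open scoped ComplexOrder

noncomputable section

namespace HigherOrder

/-! ### Types as expressions -/

/-- Types of the hierarchy. The non-trivial elementary systems are named by natural numbers.
`elem [a₁, …, aₖ]` is the elementary type of the composite system `a₁ ⊗ ⋯ ⊗ aₖ`; in particular
`elem [a]` is the elementary type of the system `a` and `elem []` is the trivial type `I`. -/
inductive QType : Type
  | elem (l : List ℕ) : QType
  | arrow (x y : QType) : QType

/-- The letters of the words that types are: elementary types, brackets and the arrow. -/
inductive Letter : Type
  | elem (l : List ℕ) : Letter
  | lpar : Letter
  | rpar : Letter
  | arr : Letter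
  deriving DecidableEq

/-- The elementary system `a` occurs in the letter. -/
def Letter.has (a : ℕ) : Letter → Bool
  | .elem l => decide (a ∈ l)
  | _ => false

namespace QType

/-- The trivial type `I`. -/
def triv : QType := elem []

/-- The type `x̄ = x → I`. -/
def bar (x : QType) : QType := arrow x triv

/-- The expression of a type: `word (x → y) = "(" x "→" y ")"`. -/
def word : QType → List Letter
  | elem l => [.elem l]
  | arrow x y => .lpar :: (word x ++ .arr :: (word y ++ [.rpar]))

/-- `Ele_x`: the set of non-trivial elementary systems which occur in `x`. -/
def ele : QType → Finset ℕ
  | elem l => l.toFinset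
  | arrow x y => ele x ∪ ele y

/-- No non-trivial elementary system occurs more than once in the expression of the type. -/
def NoRepeat : QType → Prop
  | elem l => l.Nodup
  | arrow x y => NoRepeat x ∧ NoRepeat y ∧ Disjoint (ele x) (ele y)

/-- `y ≺ₚ x`: the type `x` is `y → z` or `z → y` for some type `z`. -/
def ImmSub (y x : QType) : Prop := ∃ z, x = arrow y z ∨ x = arrow z y

/-- `y ≺ x`: `y` is a proper subtype of `x`. -/
def Sub : QType → QType → Prop := Relation.TransGen ImmSub

/-- `y ≼ x`: `y` is a subtype of `x`, possibly `x` itself. -/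
def SubEq : QType → QType → Prop := Relation.ReflTransGen ImmSub

end QType

/-- The part of the word `w` to the right of (the first occurrence of) the system `a`. -/
def rightOf (a : ℕ) (w : List Letter) : List Letter :=
  (w.dropWhile fun t => !t.has a).tail

/-- `K_w(a)`: the number of arrows and of open brackets to the right of `a` in `w`, modulo 2. -/
def parity (w : List Letter) (a : ℕ) : ℕ :=
  ((rightOf a w).count .arr + (rightOf a w).count .lpar) % 2

/-- `in_x = {a ∈ Ele_x | K_x(a) = 1}`. -/
def QType.inSys (x : QType) : Finset ℕ := x.ele.filter fun a => parity x.word a = 1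

/-- `out_x = Ele_x ∖ in_x`. -/
def QType.outSys (x : QType) : Finset ℕ := x.ele \ x.inSys

/-- The word has balanced brackets. -/
def Balanced (w : List Letter) : Prop :=
  (∀ p, p <+: w → p.count .rpar ≤ p.count .lpar) ∧ w.count .lpar = w.count .rpar

/-- `s` is a substring of `w` which contains `a` and `b` and has balanced brackets. -/
def IsBalancedSubstring (w : List Letter) (a b : ℕ) (s : List Letter) : Prop :=
  s <:+: w ∧ Balanced s ∧ (∃ t ∈ s, t.has a) ∧ ∃ t ∈ s, t.has b

/-- `s` is a smallest substring of `w` which contains `a` and `b` and has balanced brackets. -/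
def IsSmallestBalanced (w : List Letter) (a b : ℕ) (s : List Letter) : Prop :=
  IsBalancedSubstring w a b s ∧ ∀ s', IsBalancedSubstring w a b s' → s.length ≤ s'.length

/-- `y` is a minimal subtype of `x` among those in which both `a` and `b` occur. -/
def QType.IsMinimalFor (x : QType) (a b : ℕ) (y : QType) : Prop :=
  y.SubEq x ∧ {a, b} ⊆ y.ele ∧ ∀ y' : QType, y'.Sub y → ¬ {a, b} ⊆ y'.ele

/-! ### Operators -/

/-- The index set of the computational basis of `H_S = ⊗_{a ∈ S} ℂ^{d a}`. -/
abbrev Cfg (d : ℕ → ℕ) (S : Finset ℕ) : Type := (a : S) → Fin (d a)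

/-- Operators on `H_S`. -/
abbrev Op (d : ℕ → ℕ) (S : Finset ℕ) : Type := Matrix (Cfg d S) (Cfg d S) ℂ

/-- Operators on `H_S ⊗ H_E`, where `H_E` is a further finite-dimensional system with a basis
indexed by `E`. -/
abbrev ExtOp (d : ℕ → ℕ) (S : Finset ℕ) (E : Type) : Type :=
  Matrix (Cfg d S × E) (Cfg d S × E) ℂ

variable {d : ℕ → ℕ}

/-- The basis element of `H_S ⊗ H_T = H_{S ∪ T}` given by basis elements of `H_S` and `H_T`
(for disjoint `S` and `T`). -/
def Cfg.join {S T : Finset ℕ} (u : Cfg d S) (v : Cfg d T) : Cfg d (S ∪ T) := fun a =>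
  if h : (a : ℕ) ∈ S then u ⟨a, h⟩ else v ⟨a, (Finset.mem_union.1 a.2).resolve_left h⟩

/-- The basis element of `H_S = H_{S ∖ T} ⊗ H_T` given by basis elements of `H_{S ∖ T}` and `H_T`
(for `T ⊆ S`). -/
def Cfg.glue {S T : Finset ℕ} (u : Cfg d (S \ T)) (w : Cfg d T) : Cfg d S := fun a =>
  if h : (a : ℕ) ∈ T then w ⟨a, h⟩ else u ⟨a, Finset.mem_sdiff.2 ⟨a.2, h⟩⟩

/-- Forget the systems which are not in `T`. -/
def Cfg.restrict {S T : Finset ℕ} (h : T ⊆ S) (u : Cfg d S) : Cfg d T := fun a => u ⟨a, h a.2⟩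

/-- The image of `ρ` under `𝓜 ⊗ 𝓘_{E'}`, where `𝓜 : L(H_S) → L(H_T ⊗ H_E)` is the linear map with
Choi operator `M = ∑_{i,i'} |i⟩⟨i'| ⊗ 𝓜(|i⟩⟨i'|)`. -/
def applyExt {S T : Finset ℕ} {E E' : Type} (M : ExtOp d (S ∪ T) E) (ρ : ExtOp d S E') :
    ExtOp d T (E × E') := fun p q =>
  ∑ i : Cfg d S, ∑ i' : Cfg d S,
    M (i.join p.1, p.2.1) (i'.join q.1, q.2.1) * ρ (i, p.2.2) (i', q.2.2)

/-- The partial trace over the systems in `T` of an operator on `H_S` (for `T ⊆ S`). -/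
def partialTrace {S : Finset ℕ} (T : Finset ℕ) (R : Op d S) : Op d (S \ T) := fun u v =>
  ∑ w : Cfg d T, R (u.glue w) (v.glue w)

/-- The operator `I_a ⊗ R'` on `H_S`, for `R'` an operator on `H_{S ∖ {a}}` (for `a ∈ S`). -/
def idTensor {S : Finset ℕ} (a : ℕ) (R' : Op d (S \ {a})) : Op d S := fun u v =>
  if ∀ h : a ∈ S, u ⟨a, h⟩ = v ⟨a, h⟩ then
    R' (u.restrict Finset.sdiff_subset) (v.restrict Finset.sdiff_subset)
  else 0

/-! ### Admissible and deterministic maps -/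

/-- A pair of sets: the admissible maps and the deterministic maps of some type. -/
structure MapSets (α : Type) where
  adm : Set α
  det : Set α

/-- The admissible and the deterministic maps of type `x || E`, where the extension `x || E` of a
type by an elementary type is given by `A || E = AE` and `(x → y) || E = x → (y || E)`; note that
`(y || E) || E' = y || EE'`. -/
def maps (d : ℕ → ℕ) : (x : QType) → (E : Type) → [Fintype E] → MapSets (ExtOp d x.ele E)
  | .elem _, _, _ =>
    { adm := {M | M.PosSemidef ∧ ∃ N, (N.PosSemidef ∧ N.trace = 1) ∧ (N - M).PosSemidef}
      det := {M | M.PosSemidef ∧ M.trace = 1} }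
  | .arrow x y, E, _ =>
    -- the extension of `M` by any `E'` sends admissible maps to admissible maps
    let admPreserving (M : ExtOp d (x.ele ∪ y.ele) E) : Prop :=
      ∀ (E' : Type) [Fintype E'] [Nonempty E'],
        ∀ ρ ∈ (maps d x E').adm, applyExt M ρ ∈ (maps d y (E × E')).adm
    -- the extension of `M` by any `E'` sends deterministic maps to deterministic maps
    let detPreserving (M : ExtOp d (x.ele ∪ y.ele) E) : Prop :=
      ∀ (E' : Type) [Fintype E'] [Nonempty E'],
        ∀ ρ ∈ (maps d x E').det, applyExt M ρ ∈ (maps d y (E × E')).det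
    let adm : Set (ExtOp d (x.ele ∪ y.ele) E) :=
      {M | admPreserving M ∧ ∃ (n : ℕ) (N : Fin n → ExtOp d (x.ele ∪ y.ele) E),
        (∀ i, admPreserving (N i)) ∧ detPreserving (M + ∑ i, N i)}
    { adm := adm
      det := {M | M ∈ adm ∧ detPreserving M} }

/-- `T₁(x)`: the deterministic maps of type `x` (no extension, that is, extension by the
one-dimensional system). -/
def detMaps (d : ℕ → ℕ) (x : QType) : Set (Op d x.ele) :=
  {R | (R.submatrix Prod.fst Prod.fst : ExtOp d x.ele Unit) ∈ (maps d x Unit).det}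

/-! ### Signalling -/

/-- The operator `R` on `H_x` is no-signalling from `a` to `b` as the Choi operator of a channel
from `in_x` to `out_x`: one has `Tr_{out_x ∖ b} R = I_a ⊗ R'` for some `R'`. -/
def NoSignallingOp (x : QType) (a b : ℕ) (R : Op d x.ele) : Prop :=
  ∃ R', partialTrace (x.outSys \ {b}) R = idTensor a R'

/-- The type `x` is no-signalling from `a ∈ in_x` to `b ∈ out_x`. -/
def NoSignalling (d : ℕ → ℕ) (x : QType) (a b : ℕ) : Prop :=
  ∀ R ∈ detMaps d x, NoSignallingOp x a b R

/-- The type `x` is signalling from `a ∈ in_x` to `b ∈ out_x`. -/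
def Signalling (d : ℕ → ℕ) (x : QType) (a b : ℕ) : Prop := ¬ NoSignalling d x a b

/-- The type `x` is full-signalling from `a ∈ in_x` to `b ∈ out_x`: the type `x̄ = x → I`, for which
`b` is an input and `a` an output, is no-signalling from `b` to `a`. -/
def FullSignalling (d : ℕ → ℕ) (x : QType) (a b : ℕ) : Prop := NoSignalling d x.bar b a

/-! ### The decision problem -/

/-- An instance of the problem to decide the signalling relations: a type `x`, and systems
`src ∈ in_x` and `dst ∈ out_x`. -/
structure Query where
  x : QType
  src : ℕ
  dst : ℕ
  noRepeat : x.NoRepeat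
  src_mem : src ∈ x.inSys
  dst_mem : dst ∈ x.outSys

/-- A finite alphabet for instances. -/
inductive Sym : Type
  | bit (b : Bool) : Sym
  | comma : Sym
  | semi : Sym
  | lpar : Sym
  | rpar : Sym
  | arr : Sym
  deriving DecidableEq, Fintype

/-- The name of a system in binary, closed by a comma. -/
def encodeName (a : ℕ) : List Sym := (Computability.encodeNat a).map .bit ++ [.comma]

/-- A letter of the expression of a type; an elementary type is the list of the names of its
systems, closed by a semicolon. -/
def encodeLetter : Letter → List Sym
  | .elem l => l.flatMap encodeName ++ [.semi]
  | .lpar => [.lpar]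
  | .rpar => [.rpar]
  | .arr => [.arr]

/-- The two names, and then the expression of the type. -/
def Query.encode (q : Query) : List Sym :=
  encodeName q.src ++ encodeName q.dst ++ q.x.word.flatMap encodeLetter

end HigherOrder

end

/-!
# Signalling between the systems of a higher-order quantum type

**Deterministic maps.** `characterized` describes the maps of every type by linear algebra. The
admissible maps are the positive operators below a deterministic one, and an operator is
deterministic if and only if it is positive and its partial trace over the extension satisfies
affine conditions `Good`. To state them, decompose the operators on `H_x` into the spaces `L_b`,
where `b` is a set of systems and `L_b` is spanned by the product operators which are traceless on
the systems in `b` and the identity on the others. A deterministic map has a fixed trace, and it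
has a component in `L_b` only if `b` is allowed. Which `b` are allowed is a Boolean recursion on
the type (`QType.Allowed`): everything is allowed for an elementary type, and a nonempty `b` is
allowed for `x → y` if and only if `b ∩ Ele_x` is not allowed for `x` or `b ∩ Ele_y` is nonempty
and allowed for `y`. The induction rests on three facts: positivity of a Choi operator is seen by
applying the map to half of a maximally entangled state (`AdmPreserving.posSemidef`); the
conditions are preserved since operators expand into product operators (`good_choiMap`); they are
forced since the identity is an interior point of the positive cone, so that the deterministic maps
of type `x` reach all allowed components (`good_of_forall`).

**Signalling.** The type is no-signalling from `A` to `B` as soon as no allowed `b` contains `A`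
and otherwise only inputs and possibly `B` (`QType.Blocks`), because the components of a
deterministic map which survive the partial trace are then the identity on `A`. It is
full-signalling if every `b` which contains `B` and otherwise only outputs and possibly `A` is
allowed (`QType.Transmits`), because then `x → I` blocks from `B` to `A`. It is signalling in this
case since `{A, B}` is allowed, so that a classical correlation of the signs of `A` and `B` may be
added to the identity. Every set of outputs is allowed and no nonempty set of inputs is. It follows
that the input transmits to the output at the arrow where `A` and `B` part, and going outwards from
this arrow, passing from `x` to `x → z` turns `Transmits A B` into `Blocks B A` and conversely,
while passing from `x` to `z → x` preserves both (`QType.Meet.transmits_and_blocks`). This leaves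
transmitting or blocking from `A` to `B` according to whether `A` is an input of the subtype `y`
where the branches part.

**Words and the algorithm.** In the word of a type all proper nonempty initial segments have more
open than closed brackets, so a balanced substring cannot overlap it partially
(`nested_of_balanced`). This singles out the word of `y` without its outer brackets. One scan of
the word from left to right finds the parity of `A` in `y` with the help of one counter (`scan`,
`QType.Meet.scan_word`), and the machine `Machine.machine` performs this scan, comparing every name
it meets with the two given names, in quadratic time.
-/

namespace HigherOrder

/-! ### Words of types -/

theorem exists_has_word_iff (x : QType) (a : ℕ) : (∃ t ∈ x.word, t.has a) ↔ a ∈ x.ele := by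
  induction x with
  | elem l => simp [QType.word, QType.ele, Letter.has]
  | arrow x y hx hy =>
    simp only [QType.word, QType.ele, Finset.mem_union, ← hx, ← hy]
    simp [Letter.has, or_and_right, exists_or]

theorem count_lpar_word (x : QType) : x.word.count .lpar = x.word.count .arr := by
  induction x with
  | elem l => simp [QType.word]
  | arrow x y hx hy => simp [QType.word, hx, hy]; omega

theorem rightOf_append_of_has {a : ℕ} {u : List Letter} (v : List Letter)
    (h : ∃ t ∈ u, t.has a) : rightOf a (u ++ v) = rightOf a u ++ v := by
  induction u with
  | nil => simp at h
  | cons c u ih =>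
    by_cases hc : c.has a = true
    · simp [rightOf, hc]
    · have h' : ∃ t ∈ u, t.has a := by
        obtain ⟨t, ht, hta⟩ := h
        rcases List.mem_cons.1 ht with rfl | ht
        · exact absurd hta hc
        · exact ⟨t, ht, hta⟩
      simpa [rightOf, hc] using ih h'

theorem rightOf_append_of_not_has {a : ℕ} {u : List Letter} (v : List Letter)
    (h : ¬∃ t ∈ u, t.has a) : rightOf a (u ++ v) = rightOf a v := by
  induction u with
  | nil => simp
  | cons c u ih =>
    have hc : c.has a = false := by
      by_contra hc
      exact h ⟨c, by simp, by simpa using hc⟩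
    have h' : ¬∃ t ∈ u, t.has a := fun ⟨t, ht, hta⟩ => h ⟨t, by simp [ht], hta⟩
    simpa [rightOf, hc] using ih h'

theorem rightOf_cons_of_not_has {a : ℕ} {c : Letter} (v : List Letter) (h : c.has a = false) :
    rightOf a (c :: v) = rightOf a v := by
  simp [rightOf, h]

/-- Passing to the input type of an arrow flips the parity: one arrow and a word with as many
arrows as open brackets are added on the right. -/
theorem parity_arrow_left {x y : QType} {a : ℕ} (h : a ∈ x.ele) :
    parity (x.arrow y).word a = (parity x.word a + 1) % 2 := by
  have h1 := (exists_has_word_iff x a).2 h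
  have h2 := count_lpar_word y
  simp only [parity, QType.word]
  rw [rightOf_cons_of_not_has _ rfl, rightOf_append_of_has _ h1]
  simp
  omega

theorem parity_arrow_right {x y : QType} {a : ℕ} (hx : a ∉ x.ele) (h : a ∈ y.ele) :
    parity (x.arrow y).word a = parity y.word a := by
  have h1 := (exists_has_word_iff y a).2 h
  have h2 := mt (exists_has_word_iff x a).1 hx
  simp only [parity, QType.word]
  rw [rightOf_cons_of_not_has _ rfl, rightOf_append_of_not_has _ h2,
    rightOf_cons_of_not_has _ rfl, rightOf_append_of_has _ h1]
  simp

theorem parity_lt_two (w : List Letter) (a : ℕ) : parity w a < 2 := Nat.mod_lt _ two_pos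

namespace QType

theorem mem_inSys {x : QType} {a : ℕ} : a ∈ x.inSys ↔ a ∈ x.ele ∧ parity x.word a = 1 := by
  simp [inSys]

theorem mem_outSys {x : QType} {a : ℕ} : a ∈ x.outSys ↔ a ∈ x.ele ∧ parity x.word a = 0 := by
  have := parity_lt_two x.word a
  simp only [outSys, Finset.mem_sdiff, mem_inSys]
  constructor
  · rintro ⟨h1, h2⟩
    refine ⟨h1, ?_⟩
    by_contra h3
    exact h2 ⟨h1, by omega⟩
  · rintro ⟨h1, h2⟩
    exact ⟨h1, by simp [h2]⟩

/-! ### Subtypes -/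

theorem subEq_elem {y : QType} {l : List ℕ} : y.SubEq (elem l) ↔ y = elem l := by
  constructor
  · intro h
    rcases Relation.ReflTransGen.cases_tail h with h | ⟨z, -, w, h | h⟩
    · exact h.symm
    · cases h
    · cases h
  · rintro rfl
    exact Relation.ReflTransGen.refl

theorem sub_arrow {y a b : QType} : y.Sub (arrow a b) ↔ y.SubEq a ∨ y.SubEq b := by
  constructor
  · intro h
    obtain ⟨z, hz, w, h | h⟩ := Relation.TransGen.tail'_iff.1 h
    · cases h; exact Or.inl hz
    · cases h; exact Or.inr hz
  · rintro (h | h)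
    · exact Relation.TransGen.tail' h ⟨b, Or.inl rfl⟩
    · exact Relation.TransGen.tail' h ⟨a, Or.inr rfl⟩

theorem subEq_iff {y x : QType} : y.SubEq x ↔ y = x ∨ y.Sub x := by
  rw [SubEq, Relation.reflTransGen_iff_eq_or_transGen, Sub, eq_comm]

theorem subEq_arrow {y a b : QType} :
    y.SubEq (arrow a b) ↔ y = arrow a b ∨ y.SubEq a ∨ y.SubEq b := by
  rw [subEq_iff, sub_arrow]

theorem SubEq.ele_subset {y x : QType} (h : y.SubEq x) : y.ele ⊆ x.ele := by
  induction x with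
  | elem l => rw [subEq_elem.1 h]
  | arrow a b ha hb =>
    rcases subEq_arrow.1 h with rfl | h | h
    · exact subset_rfl
    · exact (ha h).trans Finset.subset_union_left
    · exact (hb h).trans Finset.subset_union_right

/-- `Meet A B y x`: the subtype `y` of `x` is the arrow at which the branches of the expression `x`
that lead to `A` and to `B` part. -/
inductive Meet (A B : ℕ) : QType → QType → Prop
  | split {x₁ x₂ : QType} (hA : A ∈ x₁.ele) (hB : B ∈ x₂.ele) (hA' : A ∉ x₂.ele)
      (hB' : B ∉ x₁.ele) : Meet A B (arrow x₁ x₂) (arrow x₁ x₂)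
  | split' {x₁ x₂ : QType} (hB : B ∈ x₁.ele) (hA : A ∈ x₂.ele) (hB' : B ∉ x₂.ele)
      (hA' : A ∉ x₁.ele) : Meet A B (arrow x₁ x₂) (arrow x₁ x₂)
  | left {y x₁ x₂ : QType} (hA : A ∈ x₁.ele) (hB : B ∈ x₁.ele) (hA' : A ∉ x₂.ele)
      (hB' : B ∉ x₂.ele) (h : Meet A B y x₁) : Meet A B y (arrow x₁ x₂)
  | right {y x₁ x₂ : QType} (hA : A ∈ x₂.ele) (hB : B ∈ x₂.ele) (hA' : A ∉ x₁.ele)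
      (hB' : B ∉ x₁.ele) (h : Meet A B y x₂) : Meet A B y (arrow x₁ x₂)

variable {A B : ℕ}

/-- Systems of opposite parity do not occur in a common letter, so their branches part at an
arrow. -/
theorem exists_meet {x : QType} (hx : x.NoRepeat) (hA : A ∈ x.ele) (hB : B ∈ x.ele)
    (hAB : parity x.word A ≠ parity x.word B) : ∃ y, Meet A B y x := by
  induction x with
  | elem l =>
    refine absurd ?_ hAB
    simp only [ele, List.mem_toFinset] at hA hB
    simp [parity, rightOf, word, Letter.has, hA, hB]
  | arrow x₁ x₂ h₁ h₂ =>
    obtain ⟨hx₁, hx₂, hd⟩ := hx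
    have hl : ∀ {a}, a ∈ x₁.ele → a ∉ x₂.ele := fun h h' => Finset.disjoint_left.1 hd h h'
    have hr : ∀ {a}, a ∈ x₂.ele → a ∉ x₁.ele := fun h h' => Finset.disjoint_left.1 hd h' h
    rcases Finset.mem_union.1 hA with hA | hA <;> rcases Finset.mem_union.1 hB with hB | hB
    · rw [parity_arrow_left hA, parity_arrow_left hB] at hAB
      obtain ⟨y, hy⟩ := h₁ hx₁ hA hB fun h => hAB (by rw [h])
      exact ⟨y, .left hA hB (hl hA) (hl hB) hy⟩
    · exact ⟨_, .split hA hB (hl hA) (hr hB)⟩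
    · exact ⟨_, .split' hB hA (hl hB) (hr hA)⟩
    · rw [parity_arrow_right (hr hA) hA, parity_arrow_right (hr hB) hB] at hAB
      obtain ⟨y, hy⟩ := h₂ hx₂ hA hB hAB
      exact ⟨y, .right hA hB (hr hA) (hr hB) hy⟩

namespace Meet

variable {x y : QType}

theorem symm (h : Meet A B y x) : Meet B A y x := by
  induction h with
  | split h1 h2 h3 h4 => exact .split' h1 h2 h3 h4
  | split' h1 h2 h3 h4 => exact .split h1 h2 h3 h4
  | left h1 h2 h3 h4 _ ih => exact .left h2 h1 h4 h3 ih
  | right h1 h2 h3 h4 _ ih => exact .right h2 h1 h4 h3 ih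

theorem subEq (h : Meet A B y x) : y.SubEq x := by
  induction h with
  | split | split' => exact Relation.ReflTransGen.refl
  | left _ _ _ _ _ ih => exact subEq_arrow.2 (.inr (.inl ih))
  | right _ _ _ _ _ ih => exact subEq_arrow.2 (.inr (.inr ih))

theorem splits (h : Meet A B y x) : ∃ y₁ y₂ : QType, y = arrow y₁ y₂ ∧
    ((A ∈ y₁.ele ∧ B ∈ y₂.ele) ∨ (B ∈ y₁.ele ∧ A ∈ y₂.ele)) := by
  induction h with
  | split h1 h2 _ _ => exact ⟨_, _, rfl, .inl ⟨h1, h2⟩⟩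
  | split' h1 h2 _ _ => exact ⟨_, _, rfl, .inr ⟨h1, h2⟩⟩
  | left _ _ _ _ _ ih => exact ih
  | right _ _ _ _ _ ih => exact ih

theorem mem (h : Meet A B y x) : A ∈ y.ele ∧ B ∈ y.ele := by
  obtain ⟨y₁, y₂, rfl, h | h⟩ := h.splits <;> simp [ele, h]

theorem not_mem_of_sub (h : Meet A B y x) {z : QType} (hz : z.Sub y) :
    ¬(A ∈ z.ele ∧ B ∈ z.ele) := by
  induction h with
  | split h1 h2 h3 h4 | split' h1 h2 h3 h4 =>
    rintro ⟨h5, h6⟩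
    rcases sub_arrow.1 hz with hz | hz
    · have := hz.ele_subset h5
      have := hz.ele_subset h6
      tauto
    · have := hz.ele_subset h5
      have := hz.ele_subset h6
      tauto
  | left _ _ _ _ _ ih => exact ih hz
  | right _ _ _ _ _ ih => exact ih hz

theorem subEq_of_mem (h : Meet A B y x) {z : QType} (hz : z.SubEq x) (hA : A ∈ z.ele)
    (hB : B ∈ z.ele) : y.SubEq z := by
  induction h with
  | split h1 h2 h3 h4 | split' h1 h2 h3 h4 =>
    rcases subEq_arrow.1 hz with rfl | hz | hz
    · exact Relation.ReflTransGen.refl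
    · have := hz.ele_subset hA
      have := hz.ele_subset hB
      tauto
    · have := hz.ele_subset hA
      have := hz.ele_subset hB
      tauto
  | left h1 h2 h3 h4 h ih =>
    rcases subEq_arrow.1 hz with rfl | hz | hz
    · exact subEq_arrow.2 (.inr (.inl h.subEq))
    · exact ih hz
    · exact absurd (hz.ele_subset hA) h3
  | right h1 h2 h3 h4 h ih =>
    rcases subEq_arrow.1 hz with rfl | hz | hz
    · exact subEq_arrow.2 (.inr (.inr h.subEq))
    · exact absurd (hz.ele_subset hA) h3
    · exact ih hz

theorem isMinimalFor_iff (h : Meet A B y x) {z : QType} : x.IsMinimalFor A B z ↔ z = y := by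
  simp only [IsMinimalFor, Finset.insert_subset_iff, Finset.singleton_subset_iff]
  constructor
  · rintro ⟨h1, h2, h3⟩
    rcases subEq_iff.1 (h.subEq_of_mem h1 h2.1 h2.2) with h4 | h4
    · exact h4.symm
    · exact absurd h.mem (h3 y h4)
  · rintro rfl
    exact ⟨h.subEq, h.mem, fun z hz => h.not_mem_of_sub hz⟩

end Meet

/-! ### The strings allowed by a type -/

/-- Decompose the operators on `H_x` as the direct sum of the spaces `L_b`, where `L_b` is spanned
by the product operators which are traceless on the systems in `b` and the identity on the others.
`Allowed x b` says that deterministic maps of type `x` may have a component in `L_b`. Only the part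
of `b` in `Ele_x` matters. -/
def Allowed : QType → Set ℕ → Prop
  | elem _, _ => True
  | arrow x y, b => (∀ a ∈ b, a ∉ x.ele ∧ a ∉ y.ele) ∨
      (Allowed x b → Allowed y b ∧ ∃ a ∈ b, a ∈ y.ele)

theorem allowed_of_disjoint {x : QType} {b : Set ℕ} (h : ∀ a ∈ b, a ∉ x.ele) : x.Allowed b := by
  cases x with
  | elem l => trivial
  | arrow x y =>
    refine Or.inl fun a ha => ?_
    simpa [ele] using h a ha

theorem allowed_congr {x : QType} {b c : Set ℕ} (h : ∀ a ∈ x.ele, a ∈ b ↔ a ∈ c) :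
    x.Allowed b ↔ x.Allowed c := by
  induction x with
  | elem l => rfl
  | arrow x y hx hy =>
    have h1 : ∀ a ∈ x.ele, a ∈ b ↔ a ∈ c := fun a ha => h a (by simp [ele, ha])
    have h2 : ∀ a ∈ y.ele, a ∈ b ↔ a ∈ c := fun a ha => h a (by simp [ele, ha])
    have h3 : (∀ a ∈ b, a ∉ x.ele ∧ a ∉ y.ele) ↔ ∀ a ∈ c, a ∉ x.ele ∧ a ∉ y.ele := by
      constructor
      · exact fun H a ha => ⟨fun hx => (H a ((h1 a hx).2 ha)).1 hx,
          fun hy => (H a ((h2 a hy).2 ha)).2 hy⟩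
      · exact fun H a ha => ⟨fun hx => (H a ((h1 a hx).1 ha)).1 hx,
          fun hy => (H a ((h2 a hy).1 ha)).2 hy⟩
    have h4 : (∃ a ∈ b, a ∈ y.ele) ↔ ∃ a ∈ c, a ∈ y.ele :=
      ⟨fun ⟨a, ha, hy⟩ => ⟨a, (h2 a hy).1 ha, hy⟩, fun ⟨a, ha, hy⟩ => ⟨a, (h2 a hy).2 ha, hy⟩⟩
    simp only [Allowed, hx h1, hy h2, h3, h4]

theorem NoRepeat.right_not_left {x y : QType} (h : (arrow x y).NoRepeat) {a : ℕ}
    (ha : a ∈ y.ele) : a ∉ x.ele := fun h' => Finset.disjoint_left.1 h.2.2 h' ha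

theorem allowed_out_and_not_allowed_in {x : QType} (hx : x.NoRepeat) (b : Set ℕ) :
    ((∀ a ∈ b, a ∈ x.ele → parity x.word a = 0) → x.Allowed b) ∧
    ((∀ a ∈ b, a ∈ x.ele → parity x.word a = 1) → (∃ a ∈ b, a ∈ x.ele) → ¬x.Allowed b) := by
  induction x with
  | elem l =>
    refine ⟨fun _ => trivial, ?_⟩
    rintro h ⟨a, ha, ha'⟩
    have h1 := h a ha ha'
    simp only [ele, List.mem_toFinset] at ha'
    simp [parity, rightOf, word, Letter.has, ha'] at h1
  | arrow x y ihx ihy =>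
    obtain ⟨x1, x2⟩ := ihx hx.1
    obtain ⟨y1, y2⟩ := ihy hx.2.1
    have pl : ∀ a ∈ x.ele, parity (arrow x y).word a = (parity x.word a + 1) % 2 :=
      fun a ha => parity_arrow_left ha
    have pr : ∀ a ∈ y.ele, parity (arrow x y).word a = parity y.word a :=
      fun a ha => parity_arrow_right (hx.right_not_left ha) ha
    have p2 := fun a => parity_lt_two x.word a
    constructor
    · intro h
      by_cases hb : ∃ a ∈ b, a ∈ x.ele
      · refine Or.inr fun hA => absurd hA (x2 (fun a ha hax => ?_) hb)
        have := h a ha (by simp [ele, hax])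
        rw [pl a hax] at this
        have := p2 a
        omega
      · push Not at hb
        by_cases hb' : ∃ a ∈ b, a ∈ y.ele
        · refine Or.inr fun _ => ⟨y1 fun a ha hay => ?_, hb'⟩
          rw [← pr a hay]
          exact h a ha (by simp [ele, hay])
        · push Not at hb'
          exact Or.inl fun a ha => ⟨hb a ha, hb' a ha⟩
    · rintro h ⟨c, hc, hc'⟩ (hA | hA)
      · have := hA c hc
        simp [ele, this] at hc'
      · obtain ⟨h3, h4⟩ := hA (x1 fun a ha hax => by
          have := h a ha (by simp [ele, hax])
          rw [pl a hax] at this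
          have := p2 a
          omega)
        refine y2 (fun a ha hay => ?_) h4 h3
        rw [← pr a hay]
        exact h a ha (by simp [ele, hay])

theorem allowed_of_out {x : QType} (hx : x.NoRepeat) {b : Set ℕ}
    (h : ∀ a ∈ b, a ∈ x.ele → parity x.word a = 0) : x.Allowed b :=
  (allowed_out_and_not_allowed_in hx b).1 h

theorem not_allowed_of_in {x : QType} (hx : x.NoRepeat) {b : Set ℕ}
    (h : ∀ a ∈ b, a ∈ x.ele → parity x.word a = 1) (h' : ∃ a ∈ b, a ∈ x.ele) : ¬x.Allowed b :=
  (allowed_out_and_not_allowed_in hx b).2 h h'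

/-- No string which contains `A`, and otherwise only inputs and possibly `B`, is allowed: the
combinatorial form of no-signalling from `A` to `B`. -/
def Blocks (x : QType) (A B : ℕ) : Prop :=
  ∀ b : Set ℕ, (∀ a ∈ b, a ∈ x.ele → a = B ∨ parity x.word a = 1) → A ∈ b → ¬x.Allowed b

/-- Every string which contains `B`, and otherwise only outputs and possibly `A`, is allowed: the
combinatorial form of full signalling from `A` to `B`. -/
def Transmits (x : QType) (A B : ℕ) : Prop :=
  ∀ b : Set ℕ, (∀ a ∈ b, a ∈ x.ele → a = A ∨ parity x.word a = 0) → B ∈ b → x.Allowed b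

section Steps

variable {x y : QType}

theorem Blocks.transmits_arrow (h : x.Blocks B A) :
    (arrow x y).Transmits A B := by
  intro b hb hBb
  refine Or.inr fun hA => absurd hA (h b (fun a ha hax => ?_) hBb)
  rcases hb a ha (by simp [ele, hax]) with h1 | h1
  · exact Or.inl h1
  · rw [parity_arrow_left hax] at h1
    have := parity_lt_two x.word a
    exact Or.inr (by omega)

theorem Transmits.blocks_arrow (hxy : (arrow x y).NoRepeat) (hA : A ∈ x.ele) (hB : B ∈ x.ele)
    (h : x.Transmits B A) : (arrow x y).Blocks A B := by
  intro b hb hAb hall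
  rcases hall with hall | hall
  · exact (hall A hAb).1 hA
  · obtain ⟨h1, h2⟩ := hall (h b (fun a ha hax => by
      rcases hb a ha (by simp [ele, hax]) with h1 | h1
      · exact Or.inl h1
      · rw [parity_arrow_left hax] at h1
        have := parity_lt_two x.word a
        exact Or.inr (by omega)) hAb)
    refine not_allowed_of_in hxy.2.1 (fun a ha hay => ?_) h2 h1
    rcases hb a ha (by simp [ele, hay]) with rfl | h3
    · exact absurd hB (hxy.right_not_left hay)
    · rwa [parity_arrow_right (hxy.right_not_left hay) hay] at h3

theorem Transmits.arrow_right (hxy : (arrow x y).NoRepeat) (hB : B ∈ y.ele)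
    (h : y.Transmits A B) : (arrow x y).Transmits A B := by
  intro b hb hBb
  refine Or.inr fun hall => ⟨h b (fun a ha hay => ?_) hBb, B, hBb, hB⟩
  rw [← parity_arrow_right (hxy.right_not_left hay) hay]
  exact hb a ha (by simp [ele, hay])

theorem Blocks.arrow_right (hxy : (arrow x y).NoRepeat) (hA : A ∈ y.ele) (hB : B ∈ y.ele)
    (h : y.Blocks A B) : (arrow x y).Blocks A B := by
  intro b hb hAb hall
  rcases hall with hall | hall
  · exact (hall A hAb).2 hA
  · obtain ⟨h1, -⟩ := hall (allowed_of_out hxy.1 fun a ha hax => by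
      rcases hb a ha (by simp [ele, hax]) with rfl | h1
      · exact absurd hax (hxy.right_not_left hB)
      · rw [parity_arrow_left hax] at h1
        have := parity_lt_two x.word a
        omega)
    refine h b (fun a ha hay => ?_) hAb h1
    rw [← parity_arrow_right (hxy.right_not_left hay) hay]
    exact hb a ha (by simp [ele, hay])

theorem transmits_split (hxy : (arrow x y).NoRepeat) (hA : A ∈ x.ele) (hB : B ∈ y.ele) :
    (arrow x y).Transmits A B := by
  intro b hb hBb
  refine Or.inr fun _ => ⟨allowed_of_out hxy.2.1 fun a ha hay => ?_, B, hBb, hB⟩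
  rw [← parity_arrow_right (hxy.right_not_left hay) hay]
  rcases hb a ha (by simp [ele, hay]) with rfl | h
  · exact absurd hA (hxy.right_not_left hay)
  · exact h

theorem transmits_split' (hxy : (arrow x y).NoRepeat) (hB : B ∈ x.ele) (hA : A ∈ y.ele) :
    (arrow x y).Transmits A B := by
  intro b hb hBb
  refine Or.inr fun hall => absurd hall (not_allowed_of_in hxy.1 (fun a ha hax => ?_) ⟨B, hBb, hB⟩)
  rcases hb a ha (by simp [ele, hax]) with rfl | h
  · exact absurd hax (hxy.right_not_left hA)
  · rw [parity_arrow_left hax] at h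
    have := parity_lt_two x.word a
    omega

end Steps

/-- At the arrow where `A` and `B` part, the input among them transmits to the output. Every step
out of an input type exchanges the roles of inputs and outputs and turns transmitting into
blocking in the opposite direction; every step out of an output type changes nothing. -/
theorem Meet.transmits_and_blocks {x y : QType} (h : Meet A B y x) (hx : x.NoRepeat)
    (hA : parity y.word A = 1) (hB : parity y.word B = 0) :
    (parity x.word A = 1 → x.Transmits A B) ∧ (parity x.word A = 0 → x.Blocks B A) := by
  induction h with
  | split h1 h2 h3 h4 =>
    exact ⟨fun _ => transmits_split hx h1 h2, fun h => by omega⟩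
  | split' h1 h2 h3 h4 =>
    exact ⟨fun _ => transmits_split' hx h1 h2, fun h => by omega⟩
  | @left y x₁ x₂ h1 h2 h3 h4 h ih =>
    obtain ⟨ih1, ih2⟩ := ih hx.1 hA hB
    have := parity_lt_two x₁.word A
    rw [parity_arrow_left h1]
    exact ⟨fun h => (ih2 (by omega)).transmits_arrow,
      fun h => (ih1 (by omega)).blocks_arrow hx h2 h1⟩
  | right h1 h2 h3 h4 h ih =>
    obtain ⟨ih1, ih2⟩ := ih hx.2.1 hA hB
    rw [parity_arrow_right h3 h1]
    exact ⟨fun h => (ih1 h).arrow_right hx h2, fun h => (ih2 h).arrow_right hx h2 h1⟩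

/-- `A` and `B` have opposite parities in `x` if and only if they have in `y`. -/
theorem Meet.parity_ne_iff {x y : QType} (h : Meet A B y x) :
    parity y.word A ≠ parity y.word B ↔ parity x.word A ≠ parity x.word B := by
  induction h with
  | split | split' => rfl
  | @left y x₁ x₂ h1 h2 h3 h4 h ih =>
    have := parity_lt_two x₁.word A
    have := parity_lt_two x₁.word B
    rw [ih, parity_arrow_left h1, parity_arrow_left h2]
    omega
  | right h1 h2 h3 h4 h ih =>
    rw [ih, parity_arrow_right h3 h1, parity_arrow_right h4 h2]

end QType

/-! ### Balanced substrings -/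

/-- The number of open brackets minus the number of closed brackets among the first `n` letters. -/
def excess (w : List Letter) (n : ℕ) : ℤ :=
  ((w.take n).count .lpar : ℤ) - (w.take n).count .rpar

theorem excess_append (u v : List Letter) (n : ℕ) :
    excess (u ++ v) n = excess u n + excess v (n - u.length) := by
  simp only [excess, List.take_append, List.count_append]
  push_cast
  ring

theorem excess_of_length_le {w : List Letter} {n : ℕ} (h : w.length ≤ n) :
    excess w n = excess w w.length := by
  simp [excess, List.take_of_length_le h]

theorem excess_zero (w : List Letter) : excess w 0 = 0 := by simp [excess]

theorem balanced_iff_excess {w : List Letter} :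
    Balanced w ↔ (∀ n, 0 ≤ excess w n) ∧ excess w w.length = 0 := by
  have h : excess w w.length = 0 ↔ w.count .lpar = w.count .rpar := by
    simp [excess]; omega
  rw [h, Balanced]
  refine and_congr_left fun _ => ⟨fun h n => ?_, fun h p hp => ?_⟩
  · have := h _ (List.take_prefix n w)
    simp only [excess]; omega
  · have := h p.length
    rw [excess, ← List.prefix_iff_eq_take.1 hp] at this
    omega

theorem excess_singleton (c : Letter) (n : ℕ) :
    excess [c] n = if n = 0 then 0 else excess [c] 1 := by
  cases n with
  | zero => simp [excess]
  | succ n => simp [excess]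

/-- In the word of a type, only the empty prefix and the whole word have as many open as closed
brackets; every other prefix has more open ones. -/
theorem excess_word (x : QType) (n : ℕ) : 0 ≤ excess x.word n ∧
    (0 < n → n < x.word.length → 0 < excess x.word n) ∧
    (x.word.length ≤ n → excess x.word n = 0) := by
  induction x generalizing n with
  | elem l =>
    simp only [QType.word, List.length_singleton]
    rw [excess_singleton]
    have : excess [Letter.elem l] 1 = 0 := rfl
    refine ⟨by simp [this], by omega, by simp [this]⟩
  | arrow x y ihx ihy =>
    have e : (QType.arrow x y).word =
        [.lpar] ++ (x.word ++ ([.arr] ++ (y.word ++ [.rpar]))) := by simp [QType.word]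
    have h1 : excess [Letter.lpar] 1 = 1 := rfl
    have h2 : excess [Letter.arr] 1 = 0 := rfl
    have h3 : excess [Letter.rpar] 1 = -1 := rfl
    simp only [e, excess_append, List.length_append, List.length_singleton,
      excess_singleton _ n, excess_singleton _ (_ - _), h1, h2, h3]
    have hx := ihx (n - 1)
    have hy := ihy (n - 1 - x.word.length - 1)
    split_ifs <;> simp only [zero_add, add_zero] <;> omega

theorem balanced_word (x : QType) : Balanced x.word :=
  balanced_iff_excess.2 ⟨fun n => (excess_word x n).1, (excess_word x _).2.2 le_rfl⟩

theorem Balanced.append {u v : List Letter} (hu : Balanced u) (hv : Balanced v) :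
    Balanced (u ++ v) := by
  rw [balanced_iff_excess] at *
  refine ⟨fun n => ?_, ?_⟩
  · rw [excess_append]
    exact add_nonneg (hu.1 _) (hv.1 _)
  · rw [excess_append, List.length_append, Nat.add_sub_cancel_left, hv.2,
      excess_of_length_le (Nat.le_add_right _ _), hu.2, add_zero]

theorem balanced_arr : Balanced [.arr] := by
  rw [balanced_iff_excess]
  refine ⟨fun n => ?_, rfl⟩
  rw [excess_singleton]
  split_ifs <;> rfl

theorem isInfix_of_lengths {α : Type*} {u w v p t r : List α} (h : u ++ w ++ v = p ++ t ++ r)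
    (h1 : p.length ≤ u.length) (h2 : u.length + w.length ≤ p.length + t.length) : w <:+: t := by
  obtain ⟨u', rfl⟩ : p <+: u :=
    List.prefix_of_prefix_length_le (l₃ := u ++ w ++ v) ⟨t ++ r, by simp [h]⟩ ⟨w ++ v, by simp⟩ h1
  have h' : u' ++ w ++ v = t ++ r := by simpa using h
  obtain ⟨t', rfl⟩ : u' ++ w <+: t :=
    List.prefix_of_prefix_length_le ⟨v, h'⟩ ⟨r, rfl⟩ (by simp at h2 ⊢; omega)
  exact ⟨u', t', rfl⟩

/-- A balanced substring cannot cross the boundary of the word of a type with which it shares a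
letter: inside the word of a type the excess is larger than at both ends, whereas a balanced
substring has its minimal excess at both ends. -/
theorem nested_of_balanced {x : QType} {u v p t r : List Letter} {a : ℕ}
    (h : u ++ x.word ++ v = p ++ t ++ r) (ht : Balanced t) (hta : ∃ c ∈ t, c.has a)
    (hu : ∀ c ∈ u, c.has a = false) (hv : ∀ c ∈ v, c.has a = false) :
    (u.length ≤ p.length ∧ p.length + t.length ≤ u.length + x.word.length) ∨
      (p.length ≤ u.length ∧ u.length + x.word.length ≤ p.length + t.length) := by
  obtain ⟨c, hc, hca⟩ := hta
  obtain ⟨k, hk, rfl⟩ := List.mem_iff_getElem.1 hc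
  have hget : (u ++ x.word ++ v)[p.length + k]? = some t[k] := by
    rw [h, List.append_assoc, List.getElem?_append_right (by omega), Nat.add_sub_cancel_left,
      List.getElem?_append_left hk, List.getElem?_eq_getElem hk]
  have hku : u.length ≤ p.length + k := by
    by_contra hlt
    rw [List.append_assoc, List.getElem?_append_left (by omega)] at hget
    simpa [hca] using hu _ (List.mem_of_getElem? hget)
  have hkv : p.length + k < u.length + x.word.length := by
    by_contra hlt
    rw [List.getElem?_append_right (by simp; omega)] at hget
    simpa [hca] using hv _ (List.mem_of_getElem? hget)
  rw [balanced_iff_excess] at ht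
  -- the excess of the whole word at the ends of `t` and of the word of `x`
  have he : ∀ n, excess (u ++ x.word ++ v) n = excess (p ++ t ++ r) n := fun n => by rw [h]
  simp only [excess_append, List.length_append] at he
  have hw := fun n => excess_word x n
  have u1 := fun n => @excess_of_length_le u n
  have p1 := fun n => @excess_of_length_le p n
  have t1 := fun n => @excess_of_length_le t n
  have v0 := excess_zero v
  have r0 := excess_zero r
  have e1 := he p.length
  have e2 := he (p.length + t.length)
  have e3 := he u.length
  have e4 := he (u.length + x.word.length)
  have z1 := excess_zero x.word
  have z2 := excess_zero t
  have tn := ht.1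
  have te := ht.2
  by_contra hcon
  simp only [not_or, not_and_or, not_le] at hcon
  rcases lt_trichotomy p.length u.length with hlt | heq | hgt
  · have hend : p.length + t.length < u.length + x.word.length := by omega
    rw [Nat.add_sub_cancel_left, show p.length + t.length - (p.length + t.length) = 0 by omega,
      show p.length + t.length - (u.length + x.word.length) = 0 by omega, v0, r0, te,
      u1 _ (by omega), p1 _ (by omega)] at e2
    rw [Nat.sub_self, show u.length - (p.length + t.length) = 0 by omega,
      show u.length - (u.length + x.word.length) = 0 by omega, v0, r0, z1, p1 _ (by omega)] at e3
    have := tn (u.length - p.length)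
    have := (hw (p.length + t.length - u.length)).2.1 (by omega) (by omega)
    omega
  · omega
  · have hend : u.length + x.word.length < p.length + t.length := by omega
    rw [Nat.sub_self, show p.length - (p.length + t.length) = 0 by omega,
      show p.length - (u.length + x.word.length) = 0 by omega, v0, r0, z2,
      u1 _ (by omega)] at e1
    rw [Nat.add_sub_cancel_left, show u.length + x.word.length - (p.length + t.length) = 0 by omega,
      Nat.sub_self, v0, r0, u1 _ (by omega), p1 _ (by omega),
      (hw x.word.length).2.2 le_rfl] at e4
    have := tn (u.length + x.word.length - p.length)
    have := (hw (p.length - u.length)).2.1 (by omega) (by omega)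
    omega

theorem has_eq_false_of_not_mem {x : QType} {a : ℕ} (h : a ∉ x.ele) {c : Letter}
    (hc : c ∈ x.word) : c.has a = false := by
  by_contra hca
  exact h ((exists_has_word_iff x a).1 ⟨c, hc, by simpa using hca⟩)

namespace QType.Meet

variable {A B : ℕ} {x y : QType}

theorem word_isInfix (h : Meet A B y x) : y.word <:+: x.word := by
  induction h with
  | split | split' => exact List.infix_rfl
  | @left y x₁ x₂ _ _ _ _ _ ih =>
    exact ih.trans ⟨[.lpar], .arr :: (x₂.word ++ [.rpar]), by simp [word]⟩
  | @right y x₁ x₂ _ _ _ _ _ ih =>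
    exact ih.trans ⟨.lpar :: (x₁.word ++ [.arr]), [.rpar], by simp [word]⟩

theorem isInfix_of_isBalancedSubstring (h : Meet A B y x) {s t : List Letter}
    (hs : y.word = .lpar :: (s ++ [.rpar])) (ht : IsBalancedSubstring x.word A B t) :
    s <:+: t := by
  induction h with
  | @split x₁ x₂ hA hB hA' hB' | @split' x₁ x₂ hB hA hB' hA' =>
    obtain ⟨⟨p, r, hpr⟩, hbal, htA, htB⟩ := ht
    have hs' : s = x₁.word ++ .arr :: x₂.word := by
      simp only [word, List.cons.injEq, true_and] at hs
      rw [← List.append_left_inj [Letter.rpar], ← hs]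
      simp
    subst hs'
    have e1 : [Letter.lpar] ++ x₁.word ++ (.arr :: (x₂.word ++ [.rpar])) = p ++ t ++ r := by
      rw [hpr]; simp [word]
    have e2 : (.lpar :: (x₁.word ++ [.arr])) ++ x₂.word ++ [.rpar] = p ++ t ++ r := by
      rw [hpr]; simp [word]
    have e3 : [Letter.lpar] ++ (x₁.word ++ .arr :: x₂.word) ++ [.rpar] = p ++ t ++ r := by
      rw [hpr]; simp [word]
    -- `t` meets both sides and so is contained in neither
    have n1 : ¬(t <:+: x₁.word) := fun hi => by
      obtain ⟨c, hc, hcA⟩ := htA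
      obtain ⟨c', hc', hcB⟩ := htB
      simp [has_eq_false_of_not_mem ‹_› (hi.subset hc), has_eq_false_of_not_mem ‹_› (hi.subset hc')]
        at hcA hcB
    have n2 : ¬(t <:+: x₂.word) := fun hi => by
      obtain ⟨c, hc, hcA⟩ := htA
      obtain ⟨c', hc', hcB⟩ := htB
      simp [has_eq_false_of_not_mem ‹_› (hi.subset hc), has_eq_false_of_not_mem ‹_› (hi.subset hc')]
        at hcA hcB
    have key : ∀ a b, a ∈ x₁.ele → a ∉ x₂.ele → b ∈ x₂.ele → b ∉ x₁.ele → (∃ c ∈ t, c.has a) →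
        (∃ c ∈ t, c.has b) → x₁.word ++ .arr :: x₂.word <:+: t := by
      intro a b ha ha' hb hb' hta htb
      have h1 := nested_of_balanced e1 hbal hta (by simp [Letter.has]) (by
        intro c hc
        simp only [List.mem_cons, List.mem_append, List.not_mem_nil, or_false] at hc
        rcases hc with rfl | hc | rfl
        · rfl
        · exact has_eq_false_of_not_mem ha' hc
        · rfl)
      have h2 := nested_of_balanced e2 hbal htb (by
        intro c hc
        simp only [List.mem_cons, List.mem_append, List.not_mem_nil, or_false] at hc
        rcases hc with rfl | hc | rfl
        · rfl
        · exact has_eq_false_of_not_mem hb' hc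
        · rfl) (by simp [Letter.has])
      replace h1 := h1.resolve_left fun h => n1 (isInfix_of_lengths e1.symm h.1 h.2)
      replace h2 := h2.resolve_left fun h => n2 (isInfix_of_lengths e2.symm h.1 h.2)
      refine isInfix_of_lengths e3 h1.1 ?_
      have := h2.2
      simp at this ⊢
      omega
    first
    | exact key A B hA hA' hB hB' htA htB
    | exact key B A hB hB' hA hA' htB htA
  | @left y x₁ x₂ hA hB hA' hB' h ih =>
    obtain ⟨⟨p, r, hpr⟩, hbal, htA, htB⟩ := ht
    have e1 : [Letter.lpar] ++ x₁.word ++ (.arr :: (x₂.word ++ [.rpar])) = p ++ t ++ r := by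
      rw [hpr]; simp [word]
    rcases nested_of_balanced e1 hbal htA (by simp [Letter.has]) (by
      intro c hc
      simp only [List.mem_cons, List.mem_append, List.not_mem_nil, or_false] at hc
      rcases hc with rfl | hc | rfl
      · rfl
      · exact has_eq_false_of_not_mem hA' hc
      · rfl) with h1 | h1
    · exact ih hs ⟨isInfix_of_lengths e1.symm h1.1 h1.2, hbal, htA, htB⟩
    · refine List.IsInfix.trans ?_ (isInfix_of_lengths e1 h1.1 h1.2)
      exact List.IsInfix.trans ⟨[.lpar], [.rpar], by simp [hs]⟩ h.word_isInfix
  | @right y x₁ x₂ hA hB hA' hB' h ih =>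
    obtain ⟨⟨p, r, hpr⟩, hbal, htA, htB⟩ := ht
    have e2 : (.lpar :: (x₁.word ++ [.arr])) ++ x₂.word ++ [.rpar] = p ++ t ++ r := by
      rw [hpr]; simp [word]
    rcases nested_of_balanced e2 hbal htA (by
      intro c hc
      simp only [List.mem_cons, List.mem_append, List.not_mem_nil, or_false] at hc
      rcases hc with rfl | hc | rfl
      · rfl
      · exact has_eq_false_of_not_mem hA' hc
      · rfl) (by simp [Letter.has]) with h1 | h1
    · exact ih hs ⟨isInfix_of_lengths e2.symm h1.1 h1.2, hbal, htA, htB⟩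
    · refine List.IsInfix.trans ?_ (isInfix_of_lengths e2 h1.1 h1.2)
      exact List.IsInfix.trans ⟨[.lpar], [.rpar], by simp [hs]⟩ h.word_isInfix

/-- Without its outer brackets, the word of `y` is the smallest balanced substring containing `A`
and `B`, and it assigns the same parity to `A` as `y` does. -/
theorem exists_smallest (h : Meet A B y x) : ∃ s : List Letter,
    y.word = .lpar :: (s ++ [.rpar]) ∧ (∀ t, IsSmallestBalanced x.word A B t ↔ t = s) ∧
      parity s A = parity y.word A := by
  obtain ⟨y₁, y₂, hy, hAB⟩ := h.splits
  have hs : y.word = .lpar :: ((y₁.word ++ .arr :: y₂.word) ++ [.rpar]) := by simp [hy, word]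
  have hsA : ∃ c ∈ y₁.word ++ .arr :: y₂.word, c.has A := by
    obtain ⟨c, hc, hcA⟩ := (exists_has_word_iff y A).2 h.mem.1
    rw [hs] at hc
    simp only [List.mem_cons, List.mem_append, List.not_mem_nil, or_false] at hc
    rcases hc with rfl | hc | rfl
    · cases hcA
    · exact ⟨c, by simpa using hc, hcA⟩
    · cases hcA
  have hsB : ∃ c ∈ y₁.word ++ .arr :: y₂.word, c.has B := by
    obtain ⟨c, hc, hcB⟩ := (exists_has_word_iff y B).2 h.mem.2
    rw [hs] at hc
    simp only [List.mem_cons, List.mem_append, List.not_mem_nil, or_false] at hc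
    rcases hc with rfl | hc | rfl
    · cases hcB
    · exact ⟨c, by simpa using hc, hcB⟩
    · cases hcB
  have hbal : IsBalancedSubstring x.word A B (y₁.word ++ .arr :: y₂.word) := by
    refine ⟨List.IsInfix.trans ⟨[.lpar], [.rpar], by simp [hs]⟩ h.word_isInfix, ?_, hsA, hsB⟩
    exact (balanced_word y₁).append (balanced_arr.append (balanced_word y₂))
  refine ⟨_, hs, fun t => ⟨fun ht => ?_, ?_⟩, ?_⟩
  · exact ((h.isInfix_of_isBalancedSubstring hs ht.1).eq_of_length_le (ht.2 _ hbal)).symm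
  · rintro rfl
    exact ⟨hbal, fun t ht => (h.isInfix_of_isBalancedSubstring hs ht).length_le⟩
  · rw [hs]
    simp only [parity]
    rw [rightOf_cons_of_not_has _ rfl, rightOf_append_of_has _ hsA]
    simp

end QType.Meet

/-! ### One scan of the word finds the parity -/

/-- The flags kept while the word is scanned from left to right: whether `src` and `dst` have been
seen, the parity of the number of arrows and open brackets since `src`, and whether the smallest
balanced substring with `src` and `dst` has been left. -/
structure Flags : Type where
  src : Bool
  dst : Bool
  par : Bool
  done : Bool
  deriving Fintype

/-- The effect of one letter on the flags and on the depth. The depth counts the brackets that are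
open, relative to the outermost position reached since the first of the two systems has been
seen: a closed bracket at depth `0` moves this position outwards, unless both systems have been
seen, in which case it closes the smallest balanced substring. -/
def scanLetter (A B : ℕ) (s : Flags × ℕ) : Letter → Flags × ℕ
  | .elem l =>
    ({ s.1 with src := s.1.src || decide (A ∈ l), dst := s.1.dst || decide (B ∈ l) }, s.2)
  | .lpar => if s.1.done then s else
      ({ s.1 with par := s.1.par ^^ s.1.src }, if s.1.src || s.1.dst then s.2 + 1 else s.2)
  | .arr => if s.1.done then s else ({ s.1 with par := s.1.par ^^ s.1.src }, s.2)
  | .rpar => if s.1.done then s else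
      if s.2 = 0 then ({ s.1 with done := s.1.src && s.1.dst }, 0) else (s.1, s.2 - 1)

/-- The effect of a word. -/
def scan (A B : ℕ) (s : Flags × ℕ) (w : List Letter) : Flags × ℕ := w.foldl (scanLetter A B) s

section Scan

variable {A B : ℕ}

theorem scan_cons (s : Flags × ℕ) (c : Letter) (w : List Letter) :
    scan A B s (c :: w) = scan A B (scanLetter A B s c) w := rfl

theorem scan_nil (s : Flags × ℕ) : scan A B s [] = s := rfl

theorem scan_append (s : Flags × ℕ) (v w : List Letter) :
    scan A B s (v ++ w) = scan A B (scan A B s v) w := List.foldl_append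

theorem scan_done (p : Bool) (h : ℕ) (w : List Letter) :
    scan A B (⟨true, true, p, true⟩, h) w = (⟨true, true, p, true⟩, h) := by
  induction w with
  | nil => rfl
  | cons c w ih => cases c <;> simpa [scan_cons, scanLetter] using ih

/-- The word of a type without `A` and `B` has no effect. -/
theorem scan_word_neutral {x : QType} (hA : A ∉ x.ele) (hB : B ∉ x.ele) {a b p : Bool} {h : ℕ}
    (hs : a = true ∨ b = true ∨ h = 0) :
    scan A B (⟨a, b, p, false⟩, h) x.word = (⟨a, b, p, false⟩, h) := by
  induction x generalizing p h with
  | elem l =>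
    simp only [QType.ele, List.mem_toFinset] at hA hB
    simp [QType.word, scan_cons, scan_nil, scanLetter, hA, hB]
  | arrow x y ihx ihy =>
    simp only [QType.ele, Finset.mem_union, not_or] at hA hB
    cases hab : a || b
    · obtain ⟨rfl, rfl⟩ := Bool.or_eq_false_iff.1 hab
      obtain rfl : h = 0 := by simpa using hs
      have ihx := ihx hA.1 hB.1 (p := p) (h := 0) (by simp)
      have ihy := ihy hA.2 hB.2 (p := p) (h := 0) (by simp)
      simp [QType.word, scan_cons, scan_append, scan_nil, scanLetter, ihx, ihy]
    · have hab' : a = true ∨ b = true := by simpa using hab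
      have ihx := ihx hA.1 hB.1 (p := p ^^ a) (h := h + 1) (by tauto)
      have ihy := ihy hA.2 hB.2 (p := p) (h := h + 1) (by tauto)
      simp [QType.word, scan_cons, scan_append, scan_nil, scanLetter, ihx, ihy, hab']

theorem decide_parity_flip (w : List Letter) (a : ℕ) :
    decide ((parity w a + 1) % 2 = 1) = !decide (parity w a = 1) := by
  have := parity_lt_two w a
  rw [← decide_not, decide_eq_decide]
  omega

/-- The word of a type with `A` but without `B`, before `A`. -/
theorem scan_word_src {x : QType} (hx : x.NoRepeat) (hA : A ∈ x.ele) (hB : B ∉ x.ele) {b : Bool}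
    {h : ℕ} (hs : b = true ∨ h = 0) : scan A B (⟨false, b, false, false⟩, h) x.word =
      (⟨true, b, decide (parity x.word A = 1), false⟩, h) := by
  induction x generalizing h with
  | elem l =>
    simp only [QType.ele, List.mem_toFinset] at hA hB
    simp [QType.word, scan_cons, scan_nil, scanLetter, hA, hB, parity, rightOf, Letter.has]
  | arrow x y ihx ihy =>
    simp only [QType.ele, Finset.mem_union, not_or] at hA hB
    obtain ⟨h', hh', hs', hb⟩ : ∃ h', (if b then h + 1 else h) = h' ∧ (b = true ∨ h' = 0) ∧
        ((b = true ∧ h' = h + 1) ∨ (b = false ∧ h' = 0 ∧ h = 0)) := by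
      cases b <;> simp_all
    by_cases hAx : A ∈ x.ele
    · have hAy : A ∉ y.ele := fun h => hx.right_not_left h hAx
      have ihx := ihx hx.1 hAx hB.1 hs'
      have hy := scan_word_neutral (p := !decide (parity x.word A = 1)) hAy hB.2
        (a := true) (b := b) (h := h') (by simp)
      rw [parity_arrow_left hAx, decide_parity_flip]
      rcases hb with ⟨rfl, rfl⟩ | ⟨rfl, rfl, rfl⟩ <;>
        simp_all [QType.word, scan_cons, scan_append, scan_nil, scanLetter]
    · have hAy : A ∈ y.ele := hA.resolve_left hAx
      have ihy := ihy hx.2.1 hAy hB.2 hs'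
      have hx' := scan_word_neutral (p := false) hAx hB.1 (a := false) (b := b) (h := h')
        (by simpa using hs')
      rw [parity_arrow_right hAx hAy]
      rcases hb with ⟨rfl, rfl⟩ | ⟨rfl, rfl, rfl⟩ <;>
        simp_all [QType.word, scan_cons, scan_append, scan_nil, scanLetter]

/-- The word of a type with `B` but without `A`, before `B`. -/
theorem scan_word_dst {x : QType} (hx : x.NoRepeat) (hA : A ∉ x.ele) (hB : B ∈ x.ele) {a p : Bool}
    {h : ℕ} (hs : a = true ∨ h = 0) :
    scan A B (⟨a, false, p, false⟩, h) x.word = (⟨a, true, p, false⟩, h) := by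
  induction x generalizing h p with
  | elem l =>
    simp only [QType.ele, List.mem_toFinset] at hA hB
    simp [QType.word, scan_cons, scan_nil, scanLetter, hA, hB]
  | arrow x y ihx ihy =>
    simp only [QType.ele, Finset.mem_union, not_or] at hA hB
    obtain ⟨h', hh', hs', hb⟩ : ∃ h', (if a then h + 1 else h) = h' ∧ (a = true ∨ h' = 0) ∧
        ((a = true ∧ h' = h + 1) ∨ (a = false ∧ h' = 0 ∧ h = 0)) := by
      cases a <;> simp_all
    by_cases hBx : B ∈ x.ele
    · have hBy : B ∉ y.ele := fun h => hx.right_not_left h hBx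
      have ihx := ihx hx.1 hA.1 hBx (p := p ^^ a) hs'
      have hy := scan_word_neutral (p := p) hA.2 hBy (a := a) (b := true) (h := h') (by simp)
      rcases hb with ⟨rfl, rfl⟩ | ⟨rfl, rfl, rfl⟩ <;>
        simp_all [QType.word, scan_cons, scan_append, scan_nil, scanLetter]
    · have hBy : B ∈ y.ele := hB.resolve_left hBx
      have ihy := ihy hx.2.1 hA.2 hBy (p := p) hs'
      have hx' := scan_word_neutral (p := p ^^ a) hA.1 hBx (a := a) (b := false) (h := h')
        (by simpa using hs')
      rcases hb with ⟨rfl, rfl⟩ | ⟨rfl, rfl, rfl⟩ <;>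
        simp_all [QType.word, scan_cons, scan_append, scan_nil, scanLetter]

/-- After the scan of the word of `x`, the flag `par` holds the parity of `A` in the smallest
subtype `y` with `A` and `B`. -/
theorem QType.Meet.scan_word {x y : QType} (hy : Meet A B y x) (hx : x.NoRepeat) :
    ∃ h, scan A B (⟨false, false, false, false⟩, 0) x.word =
      (⟨true, true, decide (parity y.word A = 1), true⟩, h) := by
  induction hy with
  | @split x₁ x₂ hA hB hA' hB' =>
    have h1 := scan_word_src hx.1 hA hB' (b := false) (h := 0) (by simp)
    have h2 := scan_word_dst hx.2.1 hA' hB (a := true) (h := 0)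
      (p := !decide (parity x₁.word A = 1)) (by simp)
    rw [parity_arrow_left hA, decide_parity_flip]
    exact ⟨0, by simp [QType.word, scan_cons, scan_append, scan_nil, scanLetter, h1, h2]⟩
  | @split' x₁ x₂ hB hA hB' hA' =>
    have h1 := scan_word_dst hx.1 hA' hB (a := false) (p := false) (h := 0) (by simp)
    have h2 := scan_word_src hx.2.1 hA hB' (b := true) (h := 0) (by simp)
    rw [parity_arrow_right hA' hA]
    exact ⟨0, by simp [QType.word, scan_cons, scan_append, scan_nil, scanLetter, h1, h2]⟩
  | left hA hB hA' hB' hy ih =>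
    obtain ⟨h, ih⟩ := ih hx.1
    exact ⟨h, by simp [QType.word, scan_cons, scan_append, scanLetter, ih, scan_done, scan_nil]⟩
  | right hA hB hA' hB' hy ih =>
    obtain ⟨h, ih⟩ := ih hx.2.1
    have h1 := scan_word_neutral hA' hB' (a := false) (b := false) (p := false) (h := 0) (by simp)
    exact ⟨h, by simp [QType.word, scan_cons, scan_append, scanLetter, ih, scan_nil, h1]⟩

end Scan

/-! ### The Turing machine -/

namespace Machine

/-- The stacks: the input, the names `src` and `dst`, for each name the bits which have been popped
in the course of a comparison, and the depth in unary. The answer is left on `depth`. -/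
inductive Stack : Type
  | inp
  | src
  | srcPopped
  | dst
  | dstPopped
  | depth
  deriving DecidableEq

instance : Fintype Stack :=
  ⟨{.inp, .src, .srcPopped, .dst, .dstPopped, .depth}, fun k => by cases k <;> simp⟩

/-- The alphabets of the stacks. -/
def Alph : Stack → Type
  | .inp => Sym
  | _ => Bool

/-- The labels of the program. -/
inductive Label : Type
  | readSrc
  | readDst
  | main
  | name
  | restore
  | finish
  deriving DecidableEq

instance : Fintype Label :=
  ⟨{.readSrc, .readDst, .main, .name, .restore, .finish}, fun l => by cases l <;> simp⟩

/-- The internal state: the flags of the scan, whether the bits of the current name agree so far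
with `src` and with `dst`, and registers for popped symbols. -/
structure Var : Type where
  flags : Flags
  eqSrc : Bool
  eqDst : Bool
  sym : Option Sym
  reg₁ : Option Bool
  reg₂ : Option Bool
  reg₃ : Option Bool

noncomputable instance : Fintype Var :=
  Fintype.ofInjective (fun v => (v.flags, v.eqSrc, v.eqDst, v.sym, v.reg₁, v.reg₂, v.reg₃)) <| by
    rintro ⟨⟩ ⟨⟩ h
    simpa using h

namespace Var

/-- The last symbol read is a bit. -/
def isBit (v : Var) : Bool := match v.sym with
  | some (.bit _) => true
  | _ => false

/-- The last symbol read, if it is a bit, and `false` otherwise. -/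
def bit (v : Var) : Bool := match v.sym with
  | some (.bit b) => b
  | _ => false

/-- The last symbol read is `s`. -/
def isSym (s : Sym) (v : Var) : Bool := decide (v.sym = some s)

/-- The internal state with empty registers. -/
abbrev idle (f : Flags) (s t : Bool) : Var := ⟨f, s, t, none, none, none, none⟩

/-- Empty the registers. -/
def clear (v : Var) : Var := idle v.flags v.eqSrc v.eqDst

end Var

open Turing.TM2.Stmt

/-- The statements of the program. -/
abbrev St : Type := Turing.TM2.Stmt Alph Label Var

/-- Clear the registers and continue at `l`. -/
def next (l : Label) : St := load Var.clear (goto fun _ => l)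

/-- The program. `readSrc` and `readDst` read the two names, in reverse order; `restore` moves the
popped bits of both names back; `main` reads one letter of the word, or hands over to `name`, which
compares one name of a system with both names at the same time; `finish` empties the stacks and
writes the answer. -/
def program : Label → St
  | .readSrc => pop .inp (fun v s => { v with sym := s }) <|
      branch Var.isBit (push .srcPopped Var.bit <| next .readSrc) (next .readDst)
  | .readDst => pop .inp (fun v s => { v with sym := s }) <|
      branch Var.isBit (push .dstPopped Var.bit <| next .readDst) (next .restore)
  | .restore =>
      pop .srcPopped (fun v s => { v with reg₁ := s }) <|
      pop .dstPopped (fun v s => { v with reg₂ := s }) <|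
      branch (fun v => v.reg₁.isSome)
        (push .src (fun v => v.reg₁.getD false) <|
          branch (fun v => v.reg₂.isSome)
            (push .dst (fun v => v.reg₂.getD false) <| next .restore) (next .restore))
        (branch (fun v => v.reg₂.isSome)
          (push .dst (fun v => v.reg₂.getD false) <| next .restore) (next .main))
  | .main => peek .inp (fun v s => { v with sym := s }) <|
      branch (fun v => v.sym.isNone) (next .finish) <|
      branch (fun v => v.isBit || v.isSym .comma) (next .name) <|
      pop .inp (fun v s => { v with sym := s }) <|
      branch (fun v => v.isSym .semi || v.flags.done) (next .main) <|
      branch (Var.isSym .rpar)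
        (pop .depth (fun v s => { v with reg₃ := s }) <|
          load (fun v => if v.reg₃.isNone then
            { v with flags := { v.flags with done := v.flags.src && v.flags.dst } } else v) <|
          next .main) <|
      load (fun v => { v with flags := { v.flags with par := v.flags.par ^^ v.flags.src } }) <|
      branch (fun v => v.isSym .lpar && (v.flags.src || v.flags.dst))
        (push .depth (fun _ => true) <| next .main) (next .main)
  | .name => pop .inp (fun v s => { v with sym := s }) <|
      pop .src (fun v s => { v with reg₁ := s }) <|
      pop .dst (fun v s => { v with reg₂ := s }) <|
      branch Var.isBit
        (load (fun v => { v with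
          eqSrc := v.eqSrc && decide (v.reg₁ = some v.bit)
          eqDst := v.eqDst && decide (v.reg₂ = some v.bit) }) <|
        branch (fun v => v.reg₁.isSome)
          (push .srcPopped (fun v => v.reg₁.getD false) <|
            branch (fun v => v.reg₂.isSome)
              (push .dstPopped (fun v => v.reg₂.getD false) <| next .name) (next .name))
          (branch (fun v => v.reg₂.isSome)
            (push .dstPopped (fun v => v.reg₂.getD false) <| next .name) (next .name)))
        (load (fun v => { v with
          flags := { v.flags with
            src := v.flags.src || (v.eqSrc && v.reg₁.isNone)
            dst := v.flags.dst || (v.eqDst && v.reg₂.isNone) }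
          eqSrc := true
          eqDst := true }) <|
        branch (fun v => v.reg₁.isSome)
          (push .src (fun v => v.reg₁.getD false) <|
            branch (fun v => v.reg₂.isSome)
              (push .dst (fun v => v.reg₂.getD false) <| next .restore) (next .restore))
          (branch (fun v => v.reg₂.isSome)
            (push .dst (fun v => v.reg₂.getD false) <| next .restore) (next .restore)))
  | .finish =>
      pop .src (fun v s => { v with reg₁ := s }) <|
      pop .dst (fun v s => { v with reg₂ := s }) <|
      pop .depth (fun v s => { v with reg₃ := s }) <|
      branch (fun v => v.reg₁.isSome || v.reg₂.isSome || v.reg₃.isSome) (next .finish) <|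
      push .depth (fun v => v.flags.par) <|
      load (fun _ => Var.idle ⟨false, false, false, false⟩ true true) halt

/-- The machine. -/
noncomputable def machine : Turing.FinTM2 where
  K := Stack
  k₀ := .inp
  k₁ := .depth
  Γ := Alph
  Λ := Label
  main := .readSrc
  σ := Var
  initialState := Var.idle ⟨false, false, false, false⟩ true true
  Γk₀Fin := inferInstanceAs (Fintype Sym)
  m := program

/-- The contents of the stacks. -/
def contents (i : List Sym) (a a' b b' d : List Bool) : ∀ k, List (Alph k)
  | .inp => i
  | .src => a
  | .srcPopped => a'
  | .dst => b
  | .dstPopped => b'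
  | .depth => d

/-- A configuration with empty registers. -/
def conf (l : Option Label) (f : Flags) (s t : Bool) (i : List Sym) (a a' b b' d : List Bool) :
    machine.Cfg := ⟨l, .idle f s t, contents i a a' b b' d⟩

/-- The machine comes from `c` to `c'` in at most `m` steps. -/
def Runs (m : ℕ) (c c' : machine.Cfg) : Prop :=
  ∃ n ≤ m, (flip bind machine.step)^[n] (some c) = some c'

theorem Runs.refl (c : machine.Cfg) : Runs 0 c c := ⟨0, le_rfl, rfl⟩

theorem Runs.trans {m n : ℕ} {c c' c'' : machine.Cfg} (h : Runs m c c') (h' : Runs n c' c'') :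
    Runs (m + n) c c'' := by
  obtain ⟨k, hk, h⟩ := h
  obtain ⟨k', hk', h'⟩ := h'
  exact ⟨k' + k, by omega, by rw [Function.iterate_add_apply, h, h']⟩

theorem Runs.mono {m n : ℕ} {c c' : machine.Cfg} (h : Runs m c c') (hmn : m ≤ n) : Runs n c c' := by
  obtain ⟨k, hk, h⟩ := h
  exact ⟨k, hk.trans hmn, h⟩

theorem Runs.of_step {c c' : machine.Cfg} (h : machine.step c = some c') : Runs 1 c c' :=
  ⟨1, le_rfl, h⟩

theorem Runs.head {m : ℕ} {c c' c'' : machine.Cfg} (h : machine.step c = some c')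
    (h' : Runs m c' c'') : Runs (m + 1) c c'' := by
  rw [add_comm]
  exact (Runs.of_step h).trans h'

/-- To verify one step, evaluate the statement and compare the stacks one by one; on given
constructors all of this is computation. -/
theorem step_eq_some {l : Label} {v v' : Var} {S S' : ∀ k, List (Alph k)} {l' : Option Label}
    {c : machine.Cfg} (h : Turing.TM2.stepAux (program l) v S = c) (h1 : c.l = l')
    (h2 : c.var = v') (h3 : ∀ k, c.stk k = S' k) :
    machine.step ⟨some l, v, S⟩ = some ⟨l', v', S'⟩ := by
  subst h1 h2
  have : c.stk = S' := funext h3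
  subst this
  exact congrArg some h


theorem readSrc_runs (f : Flags) (bits : List Bool) (i : List Sym) (a a' b b' d : List Bool) :
    Runs (bits.length + 1)
      (conf (some .readSrc) f true true (bits.map .bit ++ .comma :: i) a a' b b' d)
      (conf (some .readDst) f true true i a (bits.reverse ++ a') b b' d) := by
  induction bits generalizing a' with
  | nil => exact .of_step (step_eq_some rfl rfl rfl (by intro k; cases k <;> rfl))
  | cons x bits ih =>
    refine .head
      (c' := conf (some .readSrc) f true true (bits.map .bit ++ .comma :: i) a (x :: a') b b' d)
        (step_eq_some rfl rfl rfl (by intro k; cases k <;> rfl)) ?_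
    simpa using ih (x :: a')

theorem readDst_runs (f : Flags) (bits : List Bool) (i : List Sym) (a a' b b' d : List Bool) :
    Runs (bits.length + 1)
      (conf (some .readDst) f true true (bits.map .bit ++ .comma :: i) a a' b b' d)
      (conf (some .restore) f true true i a a' b (bits.reverse ++ b') d) := by
  induction bits generalizing b' with
  | nil => exact .of_step (step_eq_some rfl rfl rfl (by intro k; cases k <;> rfl))
  | cons x bits ih =>
    refine .head
      (c' := conf (some .readDst) f true true (bits.map .bit ++ .comma :: i) a a' b (x :: b') d)
        (step_eq_some rfl rfl rfl (by intro k; cases k <;> rfl)) ?_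
    simpa using ih (x :: b')

theorem restore_runs (f : Flags) (n : ℕ) (i : List Sym) (a a' b b' d : List Bool)
    (ha : a'.length ≤ n) (hb : b'.length ≤ n) :
    Runs (n + 1) (conf (some .restore) f true true i a a' b b' d)
      (conf (some .main) f true true i (a'.reverse ++ a) [] (b'.reverse ++ b) [] d) := by
  induction n generalizing a a' b b' with
  | zero =>
    obtain rfl : a' = [] := by simpa using ha
    obtain rfl : b' = [] := by simpa using hb
    exact .of_step (step_eq_some rfl rfl rfl (by intro k; cases k <;> rfl))
  | succ n ih =>
    rcases a' with _ | ⟨x, a'⟩ <;> rcases b' with _ | ⟨y, b'⟩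
    · exact Runs.mono (.of_step (step_eq_some rfl rfl rfl (by intro k; cases k <;> rfl))) (by omega)
    · refine .head (c' := conf (some .restore) f true true i a [] (y :: b) b' d)
        (step_eq_some rfl rfl rfl (by intro k; cases k <;> rfl)) ?_
      simpa using ih a [] (y :: b) b' (by simp) (by simpa using hb)
    · refine .head (c' := conf (some .restore) f true true i (x :: a) a' b [] d)
        (step_eq_some rfl rfl rfl (by intro k; cases k <;> rfl)) ?_
      simpa using ih (x :: a) a' b [] (by simpa using ha) (by simp)
    · refine .head (c' := conf (some .restore) f true true i (x :: a) a' (y :: b) b' d)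
        (step_eq_some rfl rfl rfl (by intro k; cases k <;> rfl)) ?_
      simpa using ih (x :: a) a' (y :: b) b' (by simpa using ha) (by simpa using hb)

/-- The comparison of a name with what is left of `src` and `dst`; no bit of them is lost. -/
theorem name_runs (f : Flags) (s t : Bool) (bits : List Bool) (i : List Sym)
    (a a' b b' d : List Bool) : ∃ a₁ a₁' b₁ b₁' : List Bool,
      a₁'.reverse ++ a₁ = a'.reverse ++ a ∧ b₁'.reverse ++ b₁ = b'.reverse ++ b ∧
      Runs (bits.length + 1)
        (conf (some .name) f s t (bits.map .bit ++ .comma :: i) a a' b b' d)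
        (conf (some .restore)
          { f with
            src := f.src || (s && decide (bits = a))
            dst := f.dst || (t && decide (bits = b)) }
          true true i a₁ a₁' b₁ b₁' d) := by
  induction bits generalizing s t a a' b b' with
  | nil =>
    refine ⟨a, a', b, b', rfl, rfl, .of_step ?_⟩
    rcases a with _ | ⟨x, a⟩ <;> rcases b with _ | ⟨y, b⟩ <;>
      exact step_eq_some rfl rfl rfl (by intro k; cases k <;> rfl)
  | cons v bits ih =>
    rcases a with _ | ⟨x, a⟩ <;> rcases b with _ | ⟨y, b⟩
    · obtain ⟨a₁, a₁', b₁, b₁', h1, h2, h3⟩ := ih (s && false) (t && false) [] a' [] b'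
      refine ⟨a₁, a₁', b₁, b₁', h1, h2, .head
        (c' := conf (some .name) f (s && false) (t && false)
          (bits.map .bit ++ .comma :: i) [] a' [] b' d)
        (step_eq_some rfl rfl rfl (by intro k; cases k <;> rfl)) ?_⟩
      simpa using h3
    · obtain ⟨a₁, a₁', b₁, b₁', h1, h2, h3⟩ :=
        ih (s && false) (t && decide (some y = some v)) [] a' b (y :: b')
      refine ⟨a₁, a₁', b₁, b₁', h1, by simpa using h2, .head
        (c' := conf (some .name) f (s && false) (t && decide (some y = some v))
          (bits.map .bit ++ .comma :: i) [] a' b (y :: b') d)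
        (step_eq_some rfl rfl rfl (by intro k; cases k <;> rfl)) ?_⟩
      simpa [Bool.and_assoc, eq_comm (a := y)] using h3
    · obtain ⟨a₁, a₁', b₁, b₁', h1, h2, h3⟩ :=
        ih (s && decide (some x = some v)) (t && false) a (x :: a') [] b'
      refine ⟨a₁, a₁', b₁, b₁', by simpa using h1, h2, .head
        (c' := conf (some .name) f (s && decide (some x = some v)) (t && false)
          (bits.map .bit ++ .comma :: i) a (x :: a') [] b' d)
        (step_eq_some rfl rfl rfl (by intro k; cases k <;> rfl)) ?_⟩
      simpa [Bool.and_assoc, eq_comm (a := x)] using h3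
    · obtain ⟨a₁, a₁', b₁, b₁', h1, h2, h3⟩ :=
        ih (s && decide (some x = some v)) (t && decide (some y = some v)) a (x :: a') b (y :: b')
      refine ⟨a₁, a₁', b₁, b₁', by simpa using h1, by simpa using h2, .head
        (c' := conf (some .name) f (s && decide (some x = some v)) (t && decide (some y = some v))
          (bits.map .bit ++ .comma :: i) a (x :: a') b (y :: b') d)
        (step_eq_some rfl rfl rfl (by intro k; cases k <;> rfl)) ?_⟩
      simpa [Bool.and_assoc, eq_comm (a := x), eq_comm (a := y)] using h3

theorem encodeNat_inj {m n : ℕ} :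
    Computability.encodeNat m = Computability.encodeNat n ↔ m = n :=
  (Function.LeftInverse.injective Computability.decode_encodeNat).eq_iff

/-- The configuration in which the next letter of the word is read, with the names `A` and `B`
stored. -/
def atLetter (A B : ℕ) (s : Flags × ℕ) (i : List Sym) : machine.Cfg :=
  conf (some .main) s.1 true true i (Computability.encodeNat A) [] (Computability.encodeNat B) []
    (List.replicate s.2 true)

variable {A B N : ℕ}

/-- One name is compared in `len + 1` steps and at most `N` bits are moved back afterwards. -/
theorem system_runs (hA : (Computability.encodeNat A).length ≤ N)
    (hB : (Computability.encodeNat B).length ≤ N) (f : Flags) (h n : ℕ) (i : List Sym) :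
    Runs ((N + 3) * (encodeName n).length) (atLetter A B (f, h) (encodeName n ++ i))
      (atLetter A B ({ f with src := f.src || decide (n = A), dst := f.dst || decide (n = B) }, h)
        i) := by
  obtain ⟨a, a', b, b', h1, h2, h3⟩ := name_runs f true true (Computability.encodeNat n) i
    (Computability.encodeNat A) [] (Computability.encodeNat B) [] (List.replicate h true)
  simp only [List.reverse_nil, List.nil_append] at h1 h2
  have h4 := restore_runs { f with
    src := f.src || (true && decide (Computability.encodeNat n = Computability.encodeNat A))
    dst := f.dst || (true && decide (Computability.encodeNat n = Computability.encodeNat B)) }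
    N i a a' b b' (List.replicate h true)
    (by rw [← h1] at hA; simp at hA; omega) (by rw [← h2] at hB; simp at hB; omega)
  rw [h1, h2] at h4
  have h5 : machine.step (atLetter A B (f, h) (encodeName n ++ i)) =
      some (conf (some .name) f true true ((Computability.encodeNat n).map .bit ++ .comma :: i)
        (Computability.encodeNat A) [] (Computability.encodeNat B) [] (List.replicate h true)) := by
    rw [encodeName, List.append_assoc, List.singleton_append]
    rcases Computability.encodeNat n with _ | ⟨x, l⟩ <;>
      exact step_eq_some rfl rfl rfl (by intro k; cases k <;> rfl)
  have h6 := Runs.head h5 (h3.trans h4)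
  simp only [encodeNat_inj, Bool.true_and] at h6
  refine h6.mono ?_
  simp only [encodeName, List.length_append, List.length_map, List.length_singleton]
  nlinarith

theorem systems_runs (hA : (Computability.encodeNat A).length ≤ N)
    (hB : (Computability.encodeNat B).length ≤ N) (f : Flags) (h : ℕ) (l : List ℕ) (i : List Sym) :
    Runs ((N + 3) * (l.flatMap encodeName).length)
      (atLetter A B (f, h) (l.flatMap encodeName ++ i))
      (atLetter A B (scanLetter A B (f, h) (.elem l)) i) := by
  induction l generalizing f with
  | nil => simpa [scanLetter] using Runs.refl _
  | cons n l ih =>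
    have h1 := system_runs hA hB f h n (l.flatMap encodeName ++ i)
    have h2 := h1.trans (ih _)
    simp only [List.flatMap_cons, List.append_assoc, List.length_append, mul_add]
    convert h2 using 2
    simp [scanLetter, Bool.or_assoc, eq_comm (a := n), Bool.decide_or]

theorem letter_runs (hA : (Computability.encodeNat A).length ≤ N)
    (hB : (Computability.encodeNat B).length ≤ N) (s : Flags × ℕ) (c : Letter) (i : List Sym) :
    Runs ((N + 3) * (encodeLetter c).length) (atLetter A B s (encodeLetter c ++ i))
      (atLetter A B (scanLetter A B s c) i) := by
  obtain ⟨f, h⟩ := s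
  cases c with
  | elem l =>
    have h1 := systems_runs hA hB f h l (.semi :: i)
    have h2 : Runs 1 (atLetter A B (scanLetter A B (f, h) (.elem l)) (.semi :: i))
        (atLetter A B (scanLetter A B (f, h) (.elem l)) i) :=
      .of_step (step_eq_some rfl rfl rfl (by intro k; cases k <;> rfl))
    have h3 := h1.trans h2
    simp only [encodeLetter, List.append_assoc, List.singleton_append, List.length_append,
      List.length_singleton, mul_add]
    exact h3.mono (by omega)
  | lpar =>
    refine Runs.mono (.of_step ?_) (show 1 ≤ _ by simp [encodeLetter])
    obtain ⟨a, b, p, e⟩ := f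
    cases a <;> cases b <;> cases e <;>
      exact step_eq_some rfl rfl rfl (by intro k; cases k <;> rfl)
  | arr =>
    refine Runs.mono (.of_step ?_) (show 1 ≤ _ by simp [encodeLetter])
    obtain ⟨a, b, p, e⟩ := f
    cases e <;> exact step_eq_some rfl rfl rfl (by intro k; cases k <;> rfl)
  | rpar =>
    refine Runs.mono (.of_step ?_) (show 1 ≤ _ by simp [encodeLetter])
    obtain ⟨a, b, p, e⟩ := f
    cases e <;> cases h <;> exact step_eq_some rfl rfl rfl (by intro k; cases k <;> rfl)

theorem word_runs (hA : (Computability.encodeNat A).length ≤ N)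
    (hB : (Computability.encodeNat B).length ≤ N) (s : Flags × ℕ) (w : List Letter) :
    Runs ((N + 3) * (w.flatMap encodeLetter).length) (atLetter A B s (w.flatMap encodeLetter))
      (atLetter A B (scan A B s w) []) := by
  induction w generalizing s with
  | nil => simpa [scan_nil] using Runs.refl _
  | cons c w ih =>
    rw [List.flatMap_cons, List.length_append, mul_add]
    exact (letter_runs hA hB s c _).trans (ih _)

theorem finish_runs (f : Flags) (n : ℕ) (a b d : List Bool)
    (ha : a.length ≤ n) (hb : b.length ≤ n) (hd : d.length ≤ n) :
    Runs (n + 1) (conf (some .finish) f true true [] a [] b [] d)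
      (conf none ⟨false, false, false, false⟩ true true [] [] [] [] [] [f.par]) := by
  induction n generalizing a b d with
  | zero =>
    obtain rfl : a = [] := by simpa using ha
    obtain rfl : b = [] := by simpa using hb
    obtain rfl : d = [] := by simpa using hd
    exact .of_step (step_eq_some rfl rfl rfl (by intro k; cases k <;> rfl))
  | succ n ih =>
    by_cases hnil : a = [] ∧ b = [] ∧ d = []
    · obtain ⟨rfl, rfl, rfl⟩ := hnil
      exact (Runs.of_step (step_eq_some rfl rfl rfl (by intro k; cases k <;> rfl))).mono (by omega)
    · refine .head ?_ (ih a.tail b.tail d.tail (by simp; omega) (by simp; omega) (by simp; omega))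
      rcases a with _ | ⟨x, a⟩ <;> rcases b with _ | ⟨y, b⟩ <;> rcases d with _ | ⟨z, d⟩
      · simp at hnil
      all_goals exact step_eq_some rfl rfl rfl (by intro k; cases k <;> rfl)

theorem depth_scan_le (s : Flags × ℕ) (w : List Letter) :
    (scan A B s w).2 ≤ s.2 + (w.flatMap encodeLetter).length := by
  induction w generalizing s with
  | nil => simp [scan_nil]
  | cons c w ih =>
    refine (ih _).trans ?_
    rw [List.flatMap_cons, List.length_append]
    have h1 : 0 < (encodeLetter c).length := by cases c <;> simp [encodeLetter]
    have h2 : (scanLetter A B s c).2 ≤ s.2 + 1 := by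
      cases c <;> simp only [scanLetter] <;> (try split_ifs) <;> (try simp only) <;> omega
    omega

/-- The answer of the machine. -/
def answer (q : Query) : Bool :=
  (scan q.src q.dst (⟨false, false, false, false⟩, 0) q.x.word).1.par

theorem machine_runs (q : Query) : Runs (q.encode.length ^ 2 + 7 * q.encode.length + 5)
    (conf (some .readSrc) ⟨false, false, false, false⟩ true true q.encode [] [] [] [] [])
    (conf none ⟨false, false, false, false⟩ true true [] [] [] [] [] [answer q]) := by
  set f₀ : Flags := ⟨false, false, false, false⟩
  set N := q.encode.length with hN
  set a := Computability.encodeNat q.src with ha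
  set b := Computability.encodeNat q.dst with hb
  set w := q.x.word.flatMap encodeLetter with hw
  have e : q.encode = a.map .bit ++ .comma :: (b.map .bit ++ .comma :: w) := by
    simp [Query.encode, encodeName, ha, hb, hw]
  have hlen : N = a.length + 1 + (b.length + 1 + w.length) := by
    rw [hN, e]; simp; omega
  have h1 := readSrc_runs f₀ a (b.map .bit ++ .comma :: w) [] [] [] [] []
  have h2 := readDst_runs f₀ b w [] (a.reverse ++ []) [] [] []
  have h3 := restore_runs f₀ N w [] (a.reverse ++ []) [] (b.reverse ++ []) [] (by simp; omega)
    (by simp; omega)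
  have h4 := word_runs (A := q.src) (B := q.dst) (N := N) (show a.length ≤ N by omega)
    (show b.length ≤ N by omega) (f₀, 0) q.x.word
  have h5 : machine.step (atLetter q.src q.dst (scan q.src q.dst (f₀, 0) q.x.word) []) =
      some (conf (some .finish) (scan q.src q.dst (f₀, 0) q.x.word).1 true true [] a [] b []
        (List.replicate (scan q.src q.dst (f₀, 0) q.x.word).2 true)) :=
    step_eq_some rfl rfl rfl (by intro k; cases k <;> rfl)
  have h6 := finish_runs (scan q.src q.dst (f₀, 0) q.x.word).1 N a b
    (List.replicate (scan q.src q.dst (f₀, 0) q.x.word).2 true) (by omega) (by omega) (by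
      have := depth_scan_le (A := q.src) (B := q.dst) (f₀, 0) q.x.word
      rw [← hw] at this
      simp only [List.length_replicate]
      omega)
  simp only [List.append_nil, List.reverse_reverse] at h2 h3 h1
  rw [e]
  refine (h1.trans <| h2.trans <| h3.trans <| h4.trans <| .head h5 h6).mono ?_
  have : (N + 3) * w.length ≤ (N + 3) * N := Nat.mul_le_mul_left _ (by omega)
  rw [← hw]
  nlinarith

/-- The machine answers every query in polynomial time. -/
noncomputable def computable :
    Turing.TM2ComputableInPolyTime Query.encode Computability.encodeBool answer where
  tm := machine
  inputAlphabet := Equiv.refl Sym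
  outputAlphabet := Equiv.refl Bool
  time := .X ^ 2 + 7 * .X + 5
  outputsFun q := by
    refine Classical.choice ?_
    obtain ⟨n, hn, h⟩ := machine_runs q
    refine ⟨⟨⟨n, ?_⟩, by simpa using hn⟩⟩
    have h0 : (q.encode.map (Equiv.refl Sym).invFun : List Sym) = q.encode := List.map_id _
    have h1 : Turing.initList machine q.encode =
        conf (some .readSrc) ⟨false, false, false, false⟩ true true q.encode [] [] [] [] [] := by
      simp only [Turing.initList, conf]
      congr 1
      funext k
      cases k <;> rfl
    have h2 : Turing.haltList machine
        ((Computability.encodeBool (answer q)).map (Equiv.refl Bool).invFun) =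
        conf none ⟨false, false, false, false⟩ true true [] [] [] [] [] [answer q] := by
      simp only [Turing.haltList, conf]
      congr 1
      funext k
      cases k <;> rfl
    rw [← h1] at h
    refine Eq.trans ?_ (h.trans (congrArg some h2.symm))
    exact congrArg
      (fun l => (flip bind machine.step)^[n] (some (Turing.initList machine l))) h0

end Machine

variable {d : ℕ → ℕ}

/-! ### Product operators -/

/-- The product operator `⨂_{a ∈ S} t_a`. -/
def tens (S : Finset ℕ) (t : (a : ℕ) → Matrix (Fin (d a)) (Fin (d a)) ℂ) : Op d S :=
  Matrix.of fun u v => ∏ a : S, t a (u a) (v a)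

/-- The bilinear pairing of an operator with a product operator: the sum of the products of the
matrix entries. -/
def pair {S : Finset ℕ} (t : (a : ℕ) → Matrix (Fin (d a)) (Fin (d a)) ℂ) : Op d S →ₗ[ℂ] ℂ where
  toFun R := ∑ u, ∑ v, R u v * tens S t u v
  map_add' R R' := by simp [add_mul, Finset.sum_add_distrib]
  map_smul' c R := by simp [mul_assoc, Finset.mul_sum]

/-- The product operator of the matrices `t` is traceless on the systems in `b` and the identity on
the others. -/
def IsTest (b : Set ℕ) (t : (a : ℕ) → Matrix (Fin (d a)) (Fin (d a)) ℂ) : Prop :=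
  (∀ a ∈ b, (t a).trace = 0) ∧ ∀ a ∉ b, t a = 1

theorem pair_apply {S : Finset ℕ} (t : (a : ℕ) → Matrix (Fin (d a)) (Fin (d a)) ℂ) (R : Op d S) :
    pair t R = ∑ u, ∑ v, R u v * tens S t u v := rfl

theorem tens_apply {S : Finset ℕ} (t : (a : ℕ) → Matrix (Fin (d a)) (Fin (d a)) ℂ) (u v : Cfg d S) :
    tens S t u v = ∏ a : S, t a (u a) (v a) := rfl

theorem tens_congr {S : Finset ℕ} {t t' : (a : ℕ) → Matrix (Fin (d a)) (Fin (d a)) ℂ}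
    (h : ∀ a ∈ S, t a = t' a) : tens S t = tens S t' := by
  ext u v
  exact Finset.prod_congr rfl fun a _ => by rw [h a a.2]

theorem pair_congr {S : Finset ℕ} {t t' : (a : ℕ) → Matrix (Fin (d a)) (Fin (d a)) ℂ}
    (h : ∀ a ∈ S, t a = t' a) (R : Op d S) : pair t R = pair t' R := by
  simp only [pair_apply, tens_congr h]

theorem tens_one (S : Finset ℕ) : tens S (fun a => (1 : Matrix (Fin (d a)) (Fin (d a)) ℂ)) = 1 := by
  ext u v
  simp only [tens_apply, Matrix.one_apply, Finset.prod_ite_zero, Finset.mem_univ, true_imp_iff,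
    Finset.prod_const_one, funext_iff]

theorem pair_one {S : Finset ℕ} (R : Op d S) :
    pair (fun a => (1 : Matrix (Fin (d a)) (Fin (d a)) ℂ)) R = R.trace := by
  simp [pair_apply, tens_one, Matrix.one_apply, Matrix.trace]

theorem tens_conjTranspose (S : Finset ℕ) (t : (a : ℕ) → Matrix (Fin (d a)) (Fin (d a)) ℂ) :
    (tens S t).conjTranspose = tens S fun a => (t a).conjTranspose := by
  ext u v
  simp [tens_apply, Matrix.conjTranspose_apply]

theorem isTest_one : IsTest ∅ fun a => (1 : Matrix (Fin (d a)) (Fin (d a)) ℂ) :=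
  ⟨by simp, fun _ _ => rfl⟩

theorem IsTest.conjTranspose {b : Set ℕ} {t : (a : ℕ) → Matrix (Fin (d a)) (Fin (d a)) ℂ}
    (h : IsTest b t) : IsTest b fun a => (t a).conjTranspose :=
  ⟨fun a ha => by simp [Matrix.trace_conjTranspose, h.1 a ha], fun a ha => by simp [h.2 a ha]⟩

theorem pair_tens {S : Finset ℕ} (s t : (a : ℕ) → Matrix (Fin (d a)) (Fin (d a)) ℂ) :
    pair s (tens S t) = ∏ a : S, ∑ i, ∑ j, t a i j * s a i j := by
  simp only [pair_apply, tens_apply, ← Finset.prod_mul_distrib, Finset.prod_univ_sum,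
    Fintype.piFinset_univ]

theorem pair_tens_eq_zero {S : Finset ℕ} {s t : (a : ℕ) → Matrix (Fin (d a)) (Fin (d a)) ℂ}
    {b c : Set ℕ} (hs : IsTest b s) (ht : IsTest c t) {a : ℕ} (ha : a ∈ S)
    (hbc : ¬(a ∈ b ↔ a ∈ c)) : pair s (tens S t) = 0 := by
  rw [pair_tens]
  refine Finset.prod_eq_zero (Finset.mem_univ ⟨a, ha⟩) ?_
  by_cases hb : a ∈ b
  · have h1 := hs.1 a hb
    have h2 := ht.2 a (by tauto)
    simpa [h2, Matrix.one_apply, Matrix.trace] using h1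
  · have h1 := hs.2 a hb
    have h2 := ht.1 a (by tauto)
    simpa [h1, Matrix.one_apply, Matrix.trace] using h2

theorem prod_union {S T U : Finset ℕ} (hd : Disjoint S T) (hU : U = S ∪ T) (F : U → ℂ) :
    ∏ a, F a = (∏ a : S, F ⟨a, by rw [hU]; exact Finset.mem_union_left _ a.2⟩) *
      ∏ a : T, F ⟨a, by rw [hU]; exact Finset.mem_union_right _ a.2⟩ := by
  subst hU
  rw [← (Equiv.Finset.union S T hd).prod_comp, Fintype.prod_sum_type]
  rfl

/-! ### An expansion of operators into product operators -/

/-- A frame of the `n × n` matrices: the identity, and the traceless parts of the matrix units. -/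
noncomputable def frame (n : ℕ) : Option (Fin n × Fin n) → Matrix (Fin n) (Fin n) ℂ
  | none => 1
  | some (k, l) => Matrix.of fun i j =>
      (if i = k ∧ j = l then 1 else 0) - if k = l ∧ i = j then (n : ℂ)⁻¹ else 0

/-- The coefficient of the elements of the frame in the expansion of a matrix. -/
noncomputable def frameWeight (n : ℕ) : Option (Fin n × Fin n) → ℂ
  | none => (n : ℂ)⁻¹
  | some _ => 1

theorem trace_frame_some (n : ℕ) (k : Fin n × Fin n) : (frame n (some k)).trace = 0 := by
  obtain ⟨k, l⟩ := k
  have hn : (n : ℂ) ≠ 0 := by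
    have := k.pos
    exact_mod_cast this.ne'
  by_cases h : k = l
  · subst h
    simp [frame, Matrix.trace, Finset.sum_sub_distrib, hn]
  · have : ∀ i, ¬(i = k ∧ i = l) := fun i hi => h (hi.1.symm.trans hi.2)
    simp [frame, Matrix.trace, h, this]

theorem sum_frame (n : ℕ) (i j i' j' : Fin n) :
    ∑ k, frameWeight n k * (frame n k i j * frame n k i' j') =
      if i = i' ∧ j = j' then 1 else 0 := by
  have hn : (n : ℂ) ≠ 0 := by
    have := i.pos
    exact_mod_cast this.ne'
  have e : ∀ (p : Prop) [Decidable p] (q : Prop) [Decidable q] (z : ℂ),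
      (if p ∧ q then z else 0) = if p then if q then z else 0 else 0 := fun p _ q _ z => by
    split_ifs <;> simp_all
  simp only [Fintype.sum_option, Fintype.sum_prod_type, frame, frameWeight, Matrix.of_apply,
    one_mul, sub_mul, mul_sub, Finset.sum_sub_distrib, e, ite_mul, mul_ite, zero_mul, mul_zero,
    mul_one, Finset.sum_ite_eq, Finset.mem_univ, if_true, Matrix.one_apply]
  by_cases h1 : i = j <;> by_cases h2 : i' = j' <;> by_cases h3 : i = i' <;>
    by_cases h4 : j = j' <;> simp_all <;> exact Ne.symm h1

theorem exists_posSemidef_add {n : Type} [Fintype n] [DecidableEq n] {Z : Matrix n n ℂ}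
    (hZ : Z.IsHermitian) : ∃ C : ℝ, 0 < C ∧ ((C : ℂ) • (1 : Matrix n n ℂ) + Z).PosSemidef := by
  open scoped Matrix.Norms.L2Operator MatrixOrder in
  have h := IsSelfAdjoint.neg_algebraMap_norm_le_self (a := Z) hZ
  rw [Matrix.le_iff] at h
  refine ⟨‖Z‖ + 1, by positivity, ?_⟩
  have e : ((‖Z‖ + 1 : ℝ) : ℂ) • (1 : Matrix n n ℂ) + Z =
      Z - -algebraMap ℝ (Matrix n n ℂ) ‖Z‖ + 1 := by
    rw [Algebra.algebraMap_eq_smul_one]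
    ext i j
    by_cases hij : i = j
    · simp [hij]; ring
    · simp [hij]
  rw [e]
  exact h.add .one

/-- A choice of an element of the frame for every system in `S`, and of the identity elsewhere. -/
def extend {S : Finset ℕ} (κ : (a : S) → Option (Fin (d a) × Fin (d a))) (a : ℕ) :
    Option (Fin (d a) × Fin (d a)) := if h : a ∈ S then κ ⟨a, h⟩ else none

/-- The elements of the frame given by `κ`. -/
noncomputable def frames {S : Finset ℕ} (κ : (a : S) → Option (Fin (d a) × Fin (d a))) (a : ℕ) :
    Matrix (Fin (d a)) (Fin (d a)) ℂ := frame (d a) (extend κ a)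

/-- The systems where `κ` does not choose the identity. -/
def support {S : Finset ℕ} (κ : (a : S) → Option (Fin (d a) × Fin (d a))) : Set ℕ :=
  {a | extend κ a ≠ none}

theorem extend_coe {S : Finset ℕ} (κ : (a : S) → Option (Fin (d a) × Fin (d a))) (a : S) :
    extend κ a = κ a := by simp [extend]

theorem mem_support {S : Finset ℕ} {κ : (a : S) → Option (Fin (d a) × Fin (d a))} {a : ℕ} :
    a ∈ support κ ↔ ∃ h : a ∈ S, κ ⟨a, h⟩ ≠ none := by
  by_cases h : a ∈ S <;> simp [support, extend, h]

theorem isTest_frames {S : Finset ℕ} (κ : (a : S) → Option (Fin (d a) × Fin (d a))) :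
    IsTest (support κ) (frames κ) := by
  constructor
  · intro a ha
    obtain ⟨k, hk⟩ := Option.ne_none_iff_exists'.1 ha
    rw [frames, hk, trace_frame_some]
  · intro a ha
    have : extend κ a = none := by simpa [support] using ha
    rw [frames, this, frame]

/-- The expansion of an operator into the product operators of the frame. -/
theorem eq_sum_tens {S : Finset ℕ} (R : Op d S) :
    R = ∑ κ : (a : S) → Option (Fin (d a) × Fin (d a)),
      ((∏ a : S, frameWeight (d a) (κ a)) * pair (frames κ) R) • tens S (frames κ) := by
  ext u v
  have h : ∀ u' v' : Cfg d S, ∑ κ : (a : S) → Option (Fin (d a) × Fin (d a)),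
      (∏ a : S, frameWeight (d a) (κ a)) * (tens S (frames κ) u' v' * tens S (frames κ) u v) =
        if u' = u ∧ v' = v then 1 else 0 := by
    intro u' v'
    simp only [tens_apply, ← Finset.prod_mul_distrib, frames, extend_coe]
    have := Finset.prod_univ_sum (fun _ : S => Finset.univ) (fun a (k : Option _) =>
      frameWeight (d a) k * (frame (d a) k (u' a) (v' a) * frame (d a) k (u a) (v a)))
    rw [Fintype.piFinset_univ] at this
    rw [← this]
    simp only [sum_frame, Finset.prod_ite_zero, Finset.mem_univ, true_imp_iff,
      Finset.prod_const_one, funext_iff, forall_and]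
  rw [Matrix.sum_apply]
  simp only [Matrix.smul_apply, smul_eq_mul, pair_apply, Finset.mul_sum, Finset.sum_mul]
  rw [Finset.sum_comm]
  have h' : ∀ u' : Cfg d S, ∑ κ : (a : S) → Option (Fin (d a) × Fin (d a)), ∑ v' : Cfg d S,
      (∏ a : S, frameWeight (d a) (κ a)) * (R u' v' * tens S (frames κ) u' v') *
        tens S (frames κ) u v = ∑ v', R u' v' * if u' = u ∧ v' = v then 1 else 0 := by
    intro u'
    rw [Finset.sum_comm]
    refine Finset.sum_congr rfl fun v' _ => ?_
    rw [← h, Finset.mul_sum]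
    exact Finset.sum_congr rfl fun κ _ => by ring
  simp only [h']
  simp [ite_and]

/-! ### Choi operators -/

namespace Cfg

variable {S T : Finset ℕ}

theorem join_restrict (u : Cfg d (S ∪ T)) :
    (u.restrict Finset.subset_union_left).join (u.restrict Finset.subset_union_right) = u := by
  funext a
  by_cases h : (a : ℕ) ∈ S <;> simp [join, restrict, h]

/-- `H_{S ∪ T} = H_S ⊗ H_T`. -/
def joinEquiv (h : Disjoint S T) : Cfg d S × Cfg d T ≃ Cfg d (S ∪ T) where
  toFun p := p.1.join p.2
  invFun u := (u.restrict Finset.subset_union_left, u.restrict Finset.subset_union_right)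
  left_inv p := by
    refine Prod.ext (funext fun a => ?_) (funext fun a => ?_)
    · simp [join, restrict]
    · have : (a : ℕ) ∉ S := fun h' => Finset.disjoint_left.1 h h' a.2
      simp [join, restrict, this]
  right_inv u := join_restrict u

theorem sum_join {M : Type*} [AddCommMonoid M] (h : Disjoint S T) (F : Cfg d (S ∪ T) → M) :
    ∑ u, F u = ∑ i : Cfg d S, ∑ p : Cfg d T, F (i.join p) := by
  rw [← (joinEquiv h).sum_comp, Fintype.sum_prod_type]
  rfl

/-- `H_S = H_{S ∖ T} ⊗ H_T`. -/
def glueEquiv (h : T ⊆ S) : Cfg d (S \ T) × Cfg d T ≃ Cfg d S where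
  toFun p := p.1.glue p.2
  invFun u := (u.restrict Finset.sdiff_subset, u.restrict h)
  left_inv p := by
    refine Prod.ext (funext fun a => ?_) (funext fun a => ?_)
    · simp [glue, restrict, (Finset.mem_sdiff.1 a.2).2]
    · simp [glue, restrict]
  right_inv u := by
    funext a
    by_cases h : (a : ℕ) ∈ T <;> simp [glue, restrict, h]

end Cfg

theorem tens_join {S T : Finset ℕ} (h : Disjoint S T)
    (t : (a : ℕ) → Matrix (Fin (d a)) (Fin (d a)) ℂ) (i i' : Cfg d S) (p q : Cfg d T) :
    tens (S ∪ T) t (i.join p) (i'.join q) = tens S t i i' * tens T t p q := by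
  simp only [tens_apply]
  rw [prod_union h rfl]
  congr 1
  · refine Finset.prod_congr rfl fun a _ => ?_
    simp [Cfg.join]
  · refine Finset.prod_congr rfl fun a _ => ?_
    have : (a : ℕ) ∉ S := fun h' => Finset.disjoint_left.1 h h' a.2
    simp [Cfg.join, this]

theorem tens_glue {S T : Finset ℕ} (h : T ⊆ S)
    (t : (a : ℕ) → Matrix (Fin (d a)) (Fin (d a)) ℂ) (u v : Cfg d (S \ T)) (w w' : Cfg d T) :
    tens S t (u.glue w) (v.glue w') = tens (S \ T) t u v * tens T t w w' := by
  simp only [tens_apply]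
  rw [prod_union Finset.sdiff_disjoint (Finset.sdiff_union_of_subset h).symm]
  congr 1
  · refine Finset.prod_congr rfl fun a _ => ?_
    simp [Cfg.glue, (Finset.mem_sdiff.1 a.2).2]
  · refine Finset.prod_congr rfl fun a _ => ?_
    simp [Cfg.glue]

/-- The linear map with Choi operator `M`. -/
def choiMap {S T : Finset ℕ} (M : Op d (S ∪ T)) : Op d S →ₗ[ℂ] Op d T where
  toFun ρ := Matrix.of fun p q => ∑ i, ∑ i', M (i.join p) (i'.join q) * ρ i i'
  map_add' ρ σ := by
    ext p q
    simp [mul_add, Finset.sum_add_distrib]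
  map_smul' c ρ := by
    ext p q
    simp only [Matrix.of_apply, Matrix.smul_apply, smul_eq_mul, RingHom.id_apply, Finset.mul_sum]
    exact Finset.sum_congr rfl fun i _ => Finset.sum_congr rfl fun i' _ => by ring

theorem pair_choiMap_tens {S T : Finset ℕ} (h : Disjoint S T) (M : Op d (S ∪ T))
    (s t : (a : ℕ) → Matrix (Fin (d a)) (Fin (d a)) ℂ) :
    pair t (choiMap M (tens S s)) = pair (fun a => if a ∈ S then s a else t a) M := by
  have h1 : tens S s = tens S fun a => if a ∈ S then s a else t a :=
    tens_congr fun a ha => by simp [ha]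
  have h2 : tens T t = tens T fun a => if a ∈ S then s a else t a :=
    tens_congr fun a ha => by simp [Finset.disjoint_right.1 h ha]
  simp only [pair_apply, Cfg.sum_join h, tens_join h, h1, h2]
  simp only [choiMap, LinearMap.coe_mk, AddHom.coe_mk, Matrix.of_apply, Finset.sum_mul]
  -- both sides are sums over `i, i', p, q`
  have e : ∀ F : Cfg d S → Cfg d S → Cfg d T → Cfg d T → ℂ,
      ∑ p, ∑ q, ∑ i, ∑ i', F i i' p q = ∑ i, ∑ p, ∑ i', ∑ q, F i i' p q := by
    intro F
    calc ∑ p, ∑ q, ∑ i, ∑ i', F i i' p q = ∑ p, ∑ i, ∑ q, ∑ i', F i i' p q :=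
          Finset.sum_congr rfl fun p _ => Finset.sum_comm
      _ = ∑ i, ∑ p, ∑ q, ∑ i', F i i' p q := Finset.sum_comm
      _ = _ := Finset.sum_congr rfl fun i _ => Finset.sum_congr rfl fun p _ => Finset.sum_comm
  rw [e]
  refine Finset.sum_congr rfl fun i _ => Finset.sum_congr rfl fun p _ =>
    Finset.sum_congr rfl fun i' _ => Finset.sum_congr rfl fun q _ => by ring

/-- The partial trace over the extension. -/
def trExt {S : Finset ℕ} {E : Type} [Fintype E] (M : ExtOp d S E) : Op d S :=
  Matrix.of fun u v => ∑ e, M (u, e) (v, e)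

theorem trExt_applyExt {S T : Finset ℕ} {E E' : Type} [Fintype E] [Fintype E']
    (M : ExtOp d (S ∪ T) E) (ρ : ExtOp d S E') :
    trExt (applyExt M ρ) = choiMap (trExt M) (trExt ρ) := by
  ext p q
  simp only [trExt, applyExt, choiMap, LinearMap.coe_mk, AddHom.coe_mk, Matrix.of_apply,
    Fintype.sum_prod_type, Finset.sum_mul, Finset.mul_sum]
  calc ∑ e : E, ∑ e' : E', ∑ i : Cfg d S, ∑ i' : Cfg d S,
        M (i.join p, e) (i'.join q, e) * ρ (i, e') (i', e')
      = ∑ e : E, ∑ i : Cfg d S, ∑ e' : E', ∑ i' : Cfg d S,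
        M (i.join p, e) (i'.join q, e) * ρ (i, e') (i', e') :=
        Finset.sum_congr rfl fun e _ => Finset.sum_comm
    _ = ∑ i : Cfg d S, ∑ e : E, ∑ e' : E', ∑ i' : Cfg d S,
        M (i.join p, e) (i'.join q, e) * ρ (i, e') (i', e') := Finset.sum_comm
    _ = ∑ i : Cfg d S, ∑ e : E, ∑ i' : Cfg d S, ∑ e' : E',
        M (i.join p, e) (i'.join q, e) * ρ (i, e') (i', e') :=
        Finset.sum_congr rfl fun i _ => Finset.sum_congr rfl fun e _ => Finset.sum_comm
    _ = ∑ i : Cfg d S, ∑ i' : Cfg d S, ∑ e : E, ∑ e' : E',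
        M (i.join p, e) (i'.join q, e) * ρ (i, e') (i', e') :=
        Finset.sum_congr rfl fun i _ => Finset.sum_comm

/-- The contraction of a positive operator over a repeated index is positive. -/
theorem contract_posSemidef {α β : Type} [Fintype α] [Fintype β] {K : Matrix (α × β) (α × β) ℂ}
    (hK : K.PosSemidef) :
    (Matrix.of fun p q => ∑ i, ∑ i', K (i, p) (i', q) : Matrix β β ℂ).PosSemidef := by
  classical
  have h := hK.conjTranspose_mul_mul_same
    (Matrix.of fun (z : α × β) (q : β) => if z.2 = q then (1 : ℂ) else 0)
  convert h using 1
  ext p q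
  simp only [Matrix.mul_apply, Matrix.conjTranspose_apply, Matrix.of_apply, Fintype.sum_prod_type,
    mul_ite, mul_one, mul_zero, Finset.sum_ite_eq', Finset.mem_univ, if_true, apply_ite star,
    star_one, star_zero, ite_mul, one_mul, zero_mul]
  exact Finset.sum_comm

theorem applyExt_posSemidef {S T : Finset ℕ} {E E' : Type} [Fintype E] [Fintype E']
    {M : ExtOp d (S ∪ T) E} {ρ : ExtOp d S E'} (hM : M.PosSemidef) (hρ : ρ.PosSemidef) :
    (applyExt M ρ).PosSemidef := by
  have h1 : (Matrix.kroneckerMap (· * ·) M ρ).PosSemidef := hM.kronecker hρ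
  have h2 := contract_posSemidef (h1.submatrix
    fun z : Cfg d S × (Cfg d T × (E × E')) => ((z.1.join z.2.1, z.2.2.1), (z.1, z.2.2.2)))
  have e : applyExt M ρ = Matrix.of fun p q => ∑ i, ∑ i',
    (Matrix.kroneckerMap (· * ·) M ρ).submatrix
    (fun z : Cfg d S × (Cfg d T × (E × E')) => ((z.1.join z.2.1, z.2.2.1), (z.1, z.2.2.2)))
    (fun z : Cfg d S × (Cfg d T × (E × E')) => ((z.1.join z.2.1, z.2.2.1), (z.1, z.2.2.2)))
    (i, p) (i', q) := rfl
  rw [e]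
  exact h2

theorem applyExt_sub {S T : Finset ℕ} {E E' : Type} (M N : ExtOp d (S ∪ T) E)
    (ρ σ : ExtOp d S E') : applyExt N σ - applyExt M ρ =
      applyExt N (σ - ρ) + applyExt (N - M) ρ := by
  ext p q
  simp only [applyExt, Matrix.sub_apply, Matrix.add_apply, ← Finset.sum_sub_distrib,
    ← Finset.sum_add_distrib]
  exact Finset.sum_congr rfl fun i _ => Finset.sum_congr rfl fun i' _ => by ring

/-! ### The characterization of deterministic and admissible maps -/

/-- The trace of the deterministic maps of type `x`. -/
noncomputable def detTrace (d : ℕ → ℕ) : QType → ℝ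
  | .elem _ => 1
  | .arrow x y => detTrace d y * Fintype.card (Cfg d x.ele) / detTrace d x

/-- The affine conditions which single out the deterministic maps of type `x` among the positive
operators: the components in the spaces which are not allowed vanish, and the trace is right. -/
def Good (x : QType) (R : Op d x.ele) : Prop :=
  (∀ b t, IsTest b t → ¬x.Allowed b → pair t R = 0) ∧ R.trace = (detTrace d x : ℂ)

theorem card_cfg_pos {S : Finset ℕ} (hd : ∀ a ∈ S, 0 < d a) : 0 < Fintype.card (Cfg d S) :=
  Fintype.card_pos_iff.2 ⟨fun a => ⟨0, hd a a.2⟩⟩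

theorem detTrace_pos {x : QType} (hd : ∀ a ∈ x.ele, 0 < d a) : 0 < detTrace d x := by
  induction x with
  | elem l => exact one_pos
  | arrow x y hx hy =>
    have h1 := hx fun a ha => hd a (Finset.mem_union_left _ ha)
    have h2 := hy fun a ha => hd a (Finset.mem_union_right _ ha)
    have h3 := card_cfg_pos (d := d) (S := x.ele) fun a ha => hd a (Finset.mem_union_left _ ha)
    simp only [detTrace]
    positivity

/-- The multiple of the identity among the deterministic maps of type `x`. -/
noncomputable def mixWeight (d : ℕ → ℕ) (x : QType) : ℝ :=
  detTrace d x / Fintype.card (Cfg d x.ele)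

theorem mixWeight_pos {x : QType} (hd : ∀ a ∈ x.ele, 0 < d a) : 0 < mixWeight d x :=
  div_pos (detTrace_pos hd) (by exact_mod_cast card_cfg_pos hd)

/-- Adding to the multiple of the identity an operator `Z` with allowed components of trace zero. -/
theorem good_add {x : QType} (hd : ∀ a ∈ x.ele, 0 < d a) {Z : Op d x.ele}
    (hZ : ∀ b t, IsTest b t → ¬x.Allowed b → pair t Z = 0) (hZ' : Z.trace = 0) :
    Good x ((mixWeight d x : ℂ) • (1 : Op d x.ele) + Z) := by
  constructor
  · intro b t ht hb
    obtain ⟨a, hab, ha⟩ : ∃ a ∈ b, a ∈ x.ele := by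
      by_contra h
      push Not at h
      exact hb (QType.allowed_of_disjoint h)
    rw [map_add, map_smul, hZ b t ht hb, ← tens_one,
      pair_tens_eq_zero ht isTest_one ha (by simp [hab])]
    simp
  · have h : (Fintype.card (Cfg d x.ele) : ℂ) ≠ 0 := by exact_mod_cast (card_cfg_pos hd).ne'
    rw [Matrix.trace_add, Matrix.trace_smul, hZ', Matrix.trace_one, mixWeight]
    push_cast
    rw [add_zero, smul_eq_mul, div_mul_cancel₀ _ h]

theorem good_one {x : QType} (hd : ∀ a ∈ x.ele, 0 < d a) :
    Good x ((mixWeight d x : ℂ) • (1 : Op d x.ele)) := by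
  simpa using good_add hd (Z := 0) (by simp) (by simp)

theorem pair_tens_of_allowed {x : QType} {b c : Set ℕ}
    {s t : (a : ℕ) → Matrix (Fin (d a)) (Fin (d a)) ℂ} (hs : IsTest b s) (ht : IsTest c t)
    (hb : ¬x.Allowed b) (hc : x.Allowed c) : pair s (tens x.ele t) = 0 := by
  obtain ⟨a, ha, hbc⟩ : ∃ a ∈ x.ele, ¬(a ∈ b ↔ a ∈ c) := by
    by_contra h
    push Not at h
    exact hb ((QType.allowed_congr h).2 hc)
  exact pair_tens_eq_zero hs ht ha hbc

theorem trace_tens_eq_zero {S : Finset ℕ} {c : Set ℕ}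
    {t : (a : ℕ) → Matrix (Fin (d a)) (Fin (d a)) ℂ} (ht : IsTest c t) {a : ℕ} (ha : a ∈ S)
    (hac : a ∈ c) : (tens S t).trace = 0 := by
  rw [← pair_one, pair_tens_eq_zero isTest_one ht ha (by simp [hac])]

section Arrow

variable {x y : QType}

theorem prod_frameWeight_none (S : Finset ℕ) :
    ∏ a : S, frameWeight (d a) none = (Fintype.card (Cfg d S) : ℂ)⁻¹ := by
  simp [frameWeight, Fintype.card_pi, Finset.prod_inv_distrib]

theorem isTest_comb {S : Finset ℕ} {b : Set ℕ} {s t : (a : ℕ) → Matrix (Fin (d a)) (Fin (d a)) ℂ}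
    {c : Set ℕ} (hs : IsTest b s) (ht : IsTest c t) :
    IsTest {a | if a ∈ S then a ∈ b else a ∈ c} fun a => if a ∈ S then s a else t a := by
  constructor
  · intro a ha
    by_cases h : a ∈ S
    · simp only [Set.mem_ofPred_eq, h, if_true] at ha ⊢
      exact hs.1 a ha
    · simp only [Set.mem_ofPred_eq, h, if_false] at ha ⊢
      exact ht.1 a ha
  · intro a ha
    by_cases h : a ∈ S
    · simp only [Set.mem_ofPred_eq, h, if_true] at ha ⊢
      exact hs.2 a ha
    · simp only [Set.mem_ofPred_eq, h, if_false] at ha ⊢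
      exact ht.2 a ha

/-- A component of `M` in a space which is not allowed for `x → y` would map an allowed component
of `ρ` to one which is not allowed. -/
theorem good_choiMap (hxy : Disjoint x.ele y.ele) (hd : ∀ a ∈ x.ele, 0 < d a)
    {M : Op d (x.ele ∪ y.ele)} {ρ : Op d x.ele} (hM : Good (x.arrow y) M) (hρ : Good x ρ) :
    Good y (choiMap M ρ) := by
  have key : ∀ t, pair t (choiMap M ρ) =
      ∑ κ : (a : x.ele) → Option (Fin (d a) × Fin (d a)),
        ((∏ a : x.ele, frameWeight (d a) (κ a)) * pair (frames κ) ρ) *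
          pair (fun a => if a ∈ x.ele then frames κ a else t a) M := by
    intro t
    conv_lhs => rw [eq_sum_tens ρ]
    simp only [map_sum, map_smul, smul_eq_mul, pair_choiMap_tens hxy]
  have zero : ∀ (κ : (a : x.ele) → Option (Fin (d a) × Fin (d a))) (b : Set ℕ) t, IsTest b t →
      (∃ a, a ∈ support κ ∨ a ∈ b ∧ a ∈ y.ele) → (y.Allowed b → ∀ a ∈ b, a ∉ y.ele) →
      ((∏ a : x.ele, frameWeight (d a) (κ a)) * pair (frames κ) ρ) *
          pair (fun a => if a ∈ x.ele then frames κ a else t a) M = 0 := by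
    rintro κ b t ht ⟨a, ha⟩ hb
    by_cases hκ : x.Allowed (support κ)
    · have hc := isTest_comb (S := x.ele) (isTest_frames κ) ht
      refine mul_eq_zero_of_right _ (hM.1 _ _ hc ?_)
      have cx : ∀ a ∈ x.ele,
          a ∈ {a | if a ∈ x.ele then a ∈ support κ else a ∈ b} ↔ a ∈ support κ :=
        fun a ha => by simp [ha]
      have cy : ∀ a ∈ y.ele, a ∈ {a | if a ∈ x.ele then a ∈ support κ else a ∈ b} ↔ a ∈ b :=
        fun a ha => by simp [Finset.disjoint_right.1 hxy ha]
      rintro (h | h)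
      · rcases ha with ha | ⟨hab, ha⟩
        · have hax := (mem_support.1 ha).1
          exact (h a ((cx a hax).2 ha)).1 hax
        · exact (h a ((cy a ha).2 hab)).2 ha
      · obtain ⟨h1, a, hac, hay⟩ := h ((QType.allowed_congr cx).2 hκ)
        exact hb ((QType.allowed_congr cy).1 h1) a ((cy a hay).1 hac) hay
    · rw [hρ.1 _ _ (isTest_frames κ) hκ, mul_zero, zero_mul]
  constructor
  · intro b t ht hb
    obtain ⟨a, hab, ha⟩ : ∃ a ∈ b, a ∈ y.ele := by
      by_contra h
      push Not at h
      exact hb (QType.allowed_of_disjoint h)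
    rw [key]
    exact Finset.sum_eq_zero fun κ _ => zero κ b t ht ⟨a, .inr ⟨hab, ha⟩⟩ fun h => absurd h hb
  · rw [← pair_one, key, Finset.sum_eq_single fun _ => none]
    · have h1 : ∀ a, frames (fun a : x.ele => (none : Option (Fin (d a) × Fin (d a)))) a = 1 := by
        intro a
        simp [frames, extend, frame]
      have h2 : pair (frames fun a : x.ele => (none : Option (Fin (d a) × Fin (d a)))) ρ =
          ρ.trace := by
        rw [← pair_one]
        exact pair_congr (fun a _ => h1 a) ρ
      have h3 : pair (fun a => if a ∈ x.ele then
          frames (fun a : x.ele => (none : Option (Fin (d a) × Fin (d a)))) a else 1) M =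
          M.trace := by
        rw [← pair_one]
        exact pair_congr (fun a _ => by simp [h1]) M
      have hM' : M.trace = (detTrace d (x.arrow y) : ℂ) := hM.2
      rw [h2, h3, hρ.2, hM', prod_frameWeight_none, detTrace]
      have e1 : (detTrace d x : ℂ) ≠ 0 := by exact_mod_cast (detTrace_pos hd).ne'
      have e2 : (Fintype.card (Cfg d x.ele) : ℂ) ≠ 0 := by exact_mod_cast (card_cfg_pos hd).ne'
      push_cast
      field_simp
    · intro κ _ hκ
      refine zero κ ∅ _ isTest_one ?_ (by simp)
      obtain ⟨a, ha⟩ := Function.ne_iff.1 hκ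
      exact ⟨a, .inl (mem_support.2 ⟨a.2, ha⟩)⟩
    · simp

/-- The positive operators which satisfy the conditions for `x` span all allowed components, so
the conditions for `x → y` can be tested on them. -/
theorem good_of_forall (hxy : Disjoint x.ele y.ele) (hd : ∀ a ∈ x.ele, 0 < d a)
    {M : Op d (x.ele ∪ y.ele)}
    (h : ∀ ρ : Op d x.ele, ρ.PosSemidef → Good x ρ → Good y (choiMap M ρ)) :
    Good (x.arrow y) M := by
  have hw := mixWeight_pos hd
  have hw' : (mixWeight d x : ℂ) ≠ 0 := by exact_mod_cast hw.ne'
  have hpos : ((mixWeight d x : ℂ) • (1 : Op d x.ele)).PosSemidef :=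
    Matrix.PosSemidef.one.smul (by exact_mod_cast hw.le)
  have comb : ∀ t, pair t (choiMap M (tens x.ele t)) = pair t M := by
    intro t
    rw [pair_choiMap_tens hxy]
    simp
  -- a functional which is constant on the positive operators of `x` vanishes on allowed components
  have vanish : ∀ (t : (a : ℕ) → Matrix (Fin (d a)) (Fin (d a)) ℂ) (z : ℂ),
      (∀ ρ : Op d x.ele, ρ.PosSemidef → Good x ρ → pair t (choiMap M ρ) = z) →
      ∀ Z : Op d x.ele, Z.IsHermitian → (∀ b t, IsTest b t → ¬x.Allowed b → pair t Z = 0) →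
        Z.trace = 0 → pair t (choiMap M Z) = 0 := by
    intro t z hz Z hZ hZ1 hZ2
    obtain ⟨C, hC, hCZ⟩ := exists_posSemidef_add hZ
    have hε : (0 : ℝ) < mixWeight d x / C := by positivity
    have e : ((mixWeight d x / C : ℝ) : ℂ) • ((C : ℂ) • (1 : Op d x.ele) + Z) =
        (mixWeight d x : ℂ) • (1 : Op d x.ele) + ((mixWeight d x / C : ℝ) : ℂ) • Z := by
      rw [smul_add, smul_smul, ← Complex.ofReal_mul, div_mul_cancel₀ _ hC.ne']
    have h1 : ((mixWeight d x : ℂ) • (1 : Op d x.ele) +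
        ((mixWeight d x / C : ℝ) : ℂ) • Z).PosSemidef := by
      rw [← e]
      exact hCZ.smul (by exact_mod_cast hε.le)
    have h2 := hz _ h1 (good_add hd (fun b t ht hb => by rw [map_smul, hZ1 b t ht hb, smul_zero])
      (by rw [Matrix.trace_smul, hZ2, smul_zero]))
    rw [map_add, map_add, hz _ hpos (good_one hd), map_smul, map_smul, add_eq_left,
      smul_eq_mul] at h2
    exact (mul_eq_zero.1 h2).resolve_left (by exact_mod_cast hε.ne')
  constructor
  · intro c t ht hc
    simp only [QType.Allowed, not_or, not_forall, exists_prop] at hc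
    obtain ⟨⟨a₀, ha₀, hc₀⟩, hcx, hcy⟩ := hc
    refine (comb t).symm.trans ?_
    by_cases hx : ∃ a ∈ c, a ∈ x.ele
    · obtain ⟨a, hac, ha⟩ := hx
      have hconst : ∃ z : ℂ, ∀ ρ : Op d x.ele, ρ.PosSemidef → Good x ρ →
          pair t (choiMap M ρ) = z := by
        by_cases hy : ∃ a ∈ c, a ∈ y.ele
        · exact ⟨0, fun ρ h1 h2 => (h ρ h1 h2).1 c t ht fun h3 => hcy ⟨h3, hy⟩⟩
        · refine ⟨detTrace d y, fun ρ h1 h2 => ?_⟩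
          rw [← (h ρ h1 h2).2, ← pair_one]
          exact pair_congr (fun a ha => ht.2 a fun hac => hy ⟨a, hac, ha⟩) _
      obtain ⟨z, hz⟩ := hconst
      have ht' := ht.conjTranspose
      -- split the product operator into Hermitian and anti-Hermitian part
      set T := tens x.ele t with hT
      have hT' : T.conjTranspose = tens x.ele fun a => (t a).conjTranspose :=
        tens_conjTranspose _ _
      have v1 := vanish t z hz (T + T.conjTranspose) (by
          rw [Matrix.IsHermitian, Matrix.conjTranspose_add, Matrix.conjTranspose_conjTranspose,
            add_comm])
        (fun b s hs hb => by
          rw [map_add, hT', hT, pair_tens_of_allowed hs ht hb hcx,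
            pair_tens_of_allowed hs ht' hb hcx, add_zero])
        (by rw [Matrix.trace_add, hT', hT, trace_tens_eq_zero ht ha hac,
          trace_tens_eq_zero ht' ha hac, add_zero])
      have v2 := vanish t z hz (Complex.I • (T - T.conjTranspose)) (by
          rw [Matrix.IsHermitian, Matrix.conjTranspose_smul, Matrix.conjTranspose_sub,
            Matrix.conjTranspose_conjTranspose]
          simp [← smul_neg])
        (fun b s hs hb => by
          rw [map_smul, map_sub, hT', hT, pair_tens_of_allowed hs ht hb hcx,
            pair_tens_of_allowed hs ht' hb hcx, sub_zero, smul_zero])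
        (by rw [Matrix.trace_smul, Matrix.trace_sub, hT', hT, trace_tens_eq_zero ht ha hac,
          trace_tens_eq_zero ht' ha hac, sub_zero, smul_zero])
      rw [map_smul, map_smul, smul_eq_mul, map_sub, map_sub] at v2
      rw [map_add, map_add] at v1
      have v3 := (mul_eq_zero.1 v2).resolve_left Complex.I_ne_zero
      linear_combination (v1 + v3) / 2
    · push Not at hx
      have hy : ∃ a ∈ c, a ∈ y.ele := by
        refine ⟨a₀, ha₀, ?_⟩
        by_contra hy
        exact hc₀ ⟨hx a₀ ha₀, hy⟩
      have h1 := (h _ hpos (good_one hd)).1 c t ht fun h3 => hcy ⟨h3, hy⟩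
      have h2 : tens x.ele t = 1 := by
        rw [← tens_one]
        exact tens_congr fun a ha => ht.2 a fun hac => hx a hac ha
      rw [map_smul, map_smul, smul_eq_mul] at h1
      rw [h2]
      exact (mul_eq_zero.1 h1).resolve_left hw'
  · have h1 := (h _ hpos (good_one hd)).2
    rw [map_smul, Matrix.trace_smul, smul_eq_mul, ← pair_one, ← tens_one, comb, mixWeight] at h1
    have h2 : M.trace = pair (fun a => (1 : Matrix (Fin (d a)) (Fin (d a)) ℂ)) M :=
      (pair_one M).symm
    have e1 : (detTrace d x : ℂ) ≠ 0 := by exact_mod_cast (detTrace_pos hd).ne'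
    have e2 : (Fintype.card (Cfg d x.ele) : ℂ) ≠ 0 := by exact_mod_cast (card_cfg_pos hd).ne'
    change M.trace = _
    rw [h2, detTrace]
    push_cast at h1 ⊢
    rw [← h1]
    field_simp

end Arrow

/-- `M ⊗ I_{E'}` sends admissible maps of type `x || E'` to admissible maps of type `y || EE'`. -/
def AdmPreserving {x y : QType} {E : Type} [Fintype E] (M : ExtOp d (x.ele ∪ y.ele) E) : Prop :=
  ∀ (E' : Type) [Fintype E'] [Nonempty E'],
    ∀ ρ ∈ (maps d x E').adm, applyExt M ρ ∈ (maps d y (E × E')).adm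

/-- `M ⊗ I_{E'}` sends deterministic maps of type `x || E'` to deterministic maps of type
`y || EE'`. -/
def DetPreserving {x y : QType} {E : Type} [Fintype E] (M : ExtOp d (x.ele ∪ y.ele) E) : Prop :=
  ∀ (E' : Type) [Fintype E'] [Nonempty E'],
    ∀ ρ ∈ (maps d x E').det, applyExt M ρ ∈ (maps d y (E × E')).det

theorem mem_adm_arrow {x y : QType} {E : Type} [Fintype E] {M : ExtOp d (x.ele ∪ y.ele) E} :
    M ∈ (maps d (x.arrow y) E).adm ↔ AdmPreserving M ∧
      ∃ (n : ℕ) (N : Fin n → ExtOp d (x.ele ∪ y.ele) E),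
        (∀ i, AdmPreserving (N i)) ∧ DetPreserving (M + ∑ i, N i) := Iff.rfl

theorem mem_det_arrow {x y : QType} {E : Type} [Fintype E] {M : ExtOp d (x.ele ∪ y.ele) E} :
    M ∈ (maps d (x.arrow y) E).det ↔ M ∈ (maps d (x.arrow y) E).adm ∧ DetPreserving M := Iff.rfl

/-- The characterization of the maps of type `x`, in all extensions: the deterministic maps are the
positive operators whose partial trace over the extension satisfies the affine conditions, and the
admissible maps are the positive operators below a deterministic one. -/
def Characterized (d : ℕ → ℕ) (x : QType) : Prop :=
  ∀ (E : Type) [Fintype E] [Nonempty E] (M : ExtOp d x.ele E),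
    (M ∈ (maps d x E).det ↔ M.PosSemidef ∧ Good x (trExt M)) ∧
    (M ∈ (maps d x E).adm ↔ M.PosSemidef ∧ ∃ N ∈ (maps d x E).det, (N - M).PosSemidef)

theorem characterized_elem (l : List ℕ) : Characterized d (.elem l) := by
  intro E _ _ M
  refine ⟨?_, Iff.rfl⟩
  have h : (trExt M).trace = M.trace := by
    simp [trExt, Matrix.trace, Fintype.sum_prod_type]
  change M.PosSemidef ∧ M.trace = 1 ↔ _
  refine and_congr_right fun _ => ⟨fun h1 => ⟨fun b t _ hb => absurd trivial hb, ?_⟩, fun h1 => ?_⟩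
  · rw [h, h1]; simp [detTrace]
  · have h2 := h1.2
    rw [h] at h2
    simpa [detTrace] using h2

section Arrow

variable {x y : QType} {E : Type} [Fintype E]

/-- Applied to half of a maximally entangled state, a map returns its Choi operator. -/
theorem AdmPreserving.posSemidef [Nonempty E] (hd : ∀ a ∈ x.ele, 0 < d a) (hx : Characterized d x)
    (hy : Characterized d y) {M : ExtOp d (x.ele ∪ y.ele) E} (hM : AdmPreserving M) :
    M.PosSemidef := by
  have hw := mixWeight_pos hd
  have hw' : (mixWeight d x : ℂ) ≠ 0 := by exact_mod_cast hw.ne'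
  have : Nonempty (Cfg d x.ele) := Fintype.card_pos_iff.1 (card_cfg_pos hd)
  let v : Cfg d x.ele × Cfg d x.ele → ℂ := fun p => if p.1 = p.2 then 1 else 0
  have hρ : ((mixWeight d x : ℂ) • Matrix.vecMulVec v (star v) :
      ExtOp d x.ele (Cfg d x.ele)).PosSemidef :=
    (Matrix.posSemidef_vecMulVec_self_star v).smul (by exact_mod_cast hw.le)
  have htr : trExt ((mixWeight d x : ℂ) • Matrix.vecMulVec v (star v) :
      ExtOp d x.ele (Cfg d x.ele)) = (mixWeight d x : ℂ) • (1 : Op d x.ele) := by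
    ext i j
    by_cases hij : i = j
    · subst hij
      simp [trExt, v, Matrix.vecMulVec_apply, apply_ite]
    · simp only [trExt, v, Matrix.of_apply, Matrix.smul_apply, Matrix.vecMulVec_apply,
        Pi.star_apply, apply_ite star, star_one, star_zero, Matrix.one_apply_ne hij, smul_zero]
      refine Finset.sum_eq_zero fun k _ => ?_
      by_cases hik : i = k
      · subst hik
        simp [Ne.symm hij]
      · simp [hik]
  have hdet := ((hx _ _).1).2 ⟨hρ, by rw [htr]; exact good_one hd⟩
  have hadm := ((hx _ _).2).2 ⟨hρ, _, hdet, by rw [sub_self]; exact .zero⟩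
  have h1 := ((hy _ _).2.1 (hM _ _ hadm)).1
  have h2 := (h1.submatrix fun u : Cfg d (x.ele ∪ y.ele) × E =>
    (u.1.restrict Finset.subset_union_right, (u.2, u.1.restrict Finset.subset_union_left))).smul
    (a := (mixWeight d x : ℂ)⁻¹) (by rw [← Complex.ofReal_inv]; exact_mod_cast (inv_pos.2 hw).le)
  convert h2 using 1
  ext p q
  simp [applyExt, v, Matrix.vecMulVec_apply, Cfg.join_restrict]
  field_simp

theorem detPreserving_iff [Nonempty E] (hxy : Disjoint x.ele y.ele) (hd : ∀ a ∈ x.ele, 0 < d a)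
    (hx : Characterized d x) (hy : Characterized d y) {M : ExtOp d (x.ele ∪ y.ele) E}
    (hM : M.PosSemidef) : DetPreserving M ↔ Good (x.arrow y) (trExt M) := by
  constructor
  · intro h
    refine good_of_forall hxy hd fun ρ h1 h2 => ?_
    have htr : trExt (ρ.submatrix Prod.fst Prod.fst : ExtOp d x.ele Unit) = ρ := by
      ext i j
      simp [trExt]
    have h3 := ((hy _ _).1.1 (h Unit _ (((hx _ _).1).2
      ⟨h1.submatrix Prod.fst, by rw [htr]; exact h2⟩))).2
    rwa [trExt_applyExt, htr] at h3
  · intro h E' _ _ ρ hρ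
    obtain ⟨h1, h2⟩ := (hx _ _).1.1 hρ
    refine (hy _ _).1.2 ⟨applyExt_posSemidef hM h1, ?_⟩
    rw [trExt_applyExt]
    exact good_choiMap hxy hd h h2

theorem DetPreserving.admPreserving [Nonempty E] (hx : Characterized d x) (hy : Characterized d y)
    {M N : ExtOp d (x.ele ∪ y.ele) E} (hM : M.PosSemidef) (hNM : (N - M).PosSemidef)
    (hN : DetPreserving N) : AdmPreserving M := by
  intro E' _ _ ρ hρ
  obtain ⟨h1, σ, hσ, h2⟩ := (hx _ _).2.1 hρ
  refine (hy _ _).2.2 ⟨applyExt_posSemidef hM h1, _, hN _ _ hσ, ?_⟩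
  have hN' : N.PosSemidef := by simpa using hNM.add hM
  rw [applyExt_sub]
  exact (applyExt_posSemidef hN' h2).add (applyExt_posSemidef hNM h1)

theorem characterized_arrow (hxy : Disjoint x.ele y.ele) (hd : ∀ a ∈ x.ele, 0 < d a)
    (hx : Characterized d x) (hy : Characterized d y) : Characterized d (x.arrow y) := by
  intro E _ _ M
  change ExtOp d (x.ele ∪ y.ele) E at M
  have hdet : ∀ M : ExtOp d (x.ele ∪ y.ele) E,
      M ∈ (maps d (x.arrow y) E).det ↔ M.PosSemidef ∧ DetPreserving M := by
    intro M
    rw [mem_det_arrow, mem_adm_arrow]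
    constructor
    · rintro ⟨⟨h1, -⟩, h2⟩
      exact ⟨h1.posSemidef hd hx hy, h2⟩
    · rintro ⟨h1, h2⟩
      have h3 : (M - M).PosSemidef := by rw [sub_self]; exact .zero
      exact ⟨⟨h2.admPreserving hx hy h1 h3, 0, fun _ => 0, by simp, by simpa using h2⟩, h2⟩
  constructor
  · refine (hdet M).trans (and_congr_right fun hM => detPreserving_iff hxy hd hx hy hM)
  · refine mem_adm_arrow.trans ⟨?_, ?_⟩
    · rintro ⟨h1, n, N, hN, h2⟩
      have hM := h1.posSemidef hd hx hy
      have hsum : (∑ i, N i).PosSemidef :=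
        Matrix.posSemidef_sum _ fun i _ => (hN i).posSemidef hd hx hy
      have hle : (M + ∑ i, N i - M).PosSemidef := by rwa [add_sub_cancel_left]
      exact ⟨hM, M + ∑ i, N i, (hdet _).2 ⟨hM.add hsum, h2⟩, hle⟩
    · rintro ⟨hM, N, hN, hNM⟩
      change ExtOp d (x.ele ∪ y.ele) E at N
      obtain ⟨h1, h2⟩ := (hdet N).1 hN
      have h3 : (N - (N - M)).PosSemidef := by rwa [sub_sub_cancel]
      refine ⟨h2.admPreserving hx hy hM hNM, 1, fun _ => N - M,
        fun _ => h2.admPreserving hx hy hNM h3, ?_⟩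
      have e : M + ∑ _i : Fin 1, (N - M) = N := by simp
      rwa [e]

end Arrow

theorem characterized {x : QType} (hx : x.NoRepeat) (hd : ∀ a ∈ x.ele, 0 < d a) :
    Characterized d x := by
  induction x with
  | elem l => exact characterized_elem l
  | arrow x y ihx ihy =>
    have h1 : ∀ a ∈ x.ele, 0 < d a := fun a ha => hd a (Finset.mem_union_left _ ha)
    exact characterized_arrow hx.2.2 h1 (ihx hx.1 h1)
      (ihy hx.2.1 fun a ha => hd a (Finset.mem_union_right _ ha))

theorem mem_detMaps_iff {x : QType} (hx : x.NoRepeat) (hd : ∀ a ∈ x.ele, 0 < d a)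
    {R : Op d x.ele} : R ∈ detMaps d x ↔ R.PosSemidef ∧ Good x R := by
  have htr : trExt (R.submatrix Prod.fst Prod.fst : ExtOp d x.ele Unit) = R := by
    ext i j
    simp [trExt]
  refine ((characterized hx hd) Unit _).1.trans ?_
  rw [htr]
  refine and_congr_left fun _ => ⟨fun h => ?_, fun h => h.submatrix _⟩
  exact h.submatrix fun u => (u, ())

/-! ### Signalling -/

theorem partialTrace_tens {S T : Finset ℕ} (h : T ⊆ S)
    (t : (a : ℕ) → Matrix (Fin (d a)) (Fin (d a)) ℂ) :
    partialTrace T (tens S t) = (tens T t).trace • tens (S \ T) t := by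
  ext u v
  simp only [partialTrace, tens_glue h, ← Finset.mul_sum, Matrix.smul_apply, smul_eq_mul,
    Matrix.trace, Matrix.diag]
  ring

theorem partialTrace_sum_smul {S T : Finset ℕ} {ι : Type*} (s : Finset ι) (c : ι → ℂ)
    (R : ι → Op d S) :
    partialTrace T (∑ i ∈ s, c i • R i) = ∑ i ∈ s, c i • partialTrace T (R i) := by
  ext u v
  simp only [partialTrace, Matrix.sum_apply, Matrix.smul_apply, smul_eq_mul, Finset.mul_sum]
  exact Finset.sum_comm

theorem idTensor_sum_smul {S : Finset ℕ} {a : ℕ} {ι : Type*} (s : Finset ι) (c : ι → ℂ)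
    (R : ι → Op d (S \ {a})) :
    idTensor a (∑ i ∈ s, c i • R i) = ∑ i ∈ s, c i • idTensor a (R i) := by
  ext u v
  simp only [idTensor, Matrix.sum_apply, Matrix.smul_apply, smul_eq_mul]
  split_ifs <;> simp

theorem tens_eq_idTensor {S : Finset ℕ} {a : ℕ} (ha : a ∈ S)
    {t : (a : ℕ) → Matrix (Fin (d a)) (Fin (d a)) ℂ} (hta : t a = 1) :
    tens S t = idTensor a (tens (S \ {a}) t) := by
  ext u v
  have h := tens_glue (Finset.singleton_subset_iff.2 ha) t
    (u.restrict Finset.sdiff_subset) (v.restrict Finset.sdiff_subset)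
    (u.restrict (Finset.singleton_subset_iff.2 ha)) (v.restrict (Finset.singleton_subset_iff.2 ha))
  have e : ∀ u : Cfg d S, (u.restrict Finset.sdiff_subset : Cfg d (S \ {a})).glue
      (u.restrict (Finset.singleton_subset_iff.2 ha)) = u :=
    fun u => (Cfg.glueEquiv (Finset.singleton_subset_iff.2 ha)).right_inv u
  rw [e, e] at h
  have h1 : tens {a} t (u.restrict (Finset.singleton_subset_iff.2 ha))
      (v.restrict (Finset.singleton_subset_iff.2 ha)) = if u ⟨a, ha⟩ = v ⟨a, ha⟩ then 1 else 0 := by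
    rw [tens_apply, Fintype.prod_eq_single ⟨a, Finset.mem_singleton_self a⟩]
    · simp [hta, Matrix.one_apply, Cfg.restrict]
    · rintro ⟨b, hb⟩ hne
      exact absurd (Subtype.ext (Finset.mem_singleton.1 hb)) hne
  rw [h, h1, idTensor]
  simp [ha]

/-- The allowed components which survive the partial trace are the identity on `A`. -/
theorem noSignalling_of_blocks {x : QType} (hx : x.NoRepeat) (hd : ∀ a ∈ x.ele, 0 < d a) {A B : ℕ}
    (hA : A ∈ x.inSys) (h : x.Blocks A B) : NoSignalling d x A B := by
  intro R hR
  obtain ⟨-, hR, -⟩ := (mem_detMaps_iff hx hd).1 hR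
  have hT : x.outSys \ {B} ⊆ x.ele := Finset.sdiff_subset.trans Finset.sdiff_subset
  obtain ⟨hA1, hA2⟩ := QType.mem_inSys.1 hA
  have hA' : A ∈ x.ele \ (x.outSys \ {B}) := by
    simp [hA1, QType.mem_outSys, hA2]
  have e := eq_sum_tens R
  refine ⟨∑ κ : (a : x.ele) → Option (Fin (d a) × Fin (d a)),
    (((∏ a : x.ele, frameWeight (d a) (κ a)) * pair (frames κ) R) *
      (tens (x.outSys \ {B}) (frames κ)).trace) • tens _ (frames κ), ?_⟩
  rw [idTensor_sum_smul]
  conv_lhs => rw [e]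
  rw [partialTrace_sum_smul]
  refine Finset.sum_congr rfl fun κ _ => ?_
  rw [partialTrace_tens hT, smul_smul]
  have hκ := isTest_frames κ
  by_cases hall : x.Allowed (support κ)
  · by_cases htr : ∃ a ∈ x.outSys \ {B}, a ∈ support κ
    · obtain ⟨a, ha, haκ⟩ := htr
      rw [trace_tens_eq_zero hκ ha haκ]
      simp
    · push Not at htr
      have hAκ : A ∉ support κ := fun hAκ => by
        refine h _ (fun a ha hax => ?_) hAκ hall
        by_contra hcon
        push Not at hcon
        have := parity_lt_two x.word a
        exact htr a (by simp [QType.mem_outSys, hax, hcon.1]; omega) ha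
      rw [tens_eq_idTensor hA' (hκ.2 A hAκ)]
  · rw [hR _ _ hκ hall]
    simp

/-- The values `1, -1, 0, …, 0`. -/
def signs (n : ℕ) (i : Fin n) : ℝ := if (i : ℕ) = 0 then 1 else if (i : ℕ) = 1 then -1 else 0

theorem sum_signs {n : ℕ} (hn : 2 ≤ n) : ∑ i, signs n i = 0 := by
  obtain ⟨m, rfl⟩ := Nat.exists_eq_add_of_le' hn
  simp [signs, Fin.sum_univ_succ]

theorem abs_signs_le (n : ℕ) (i : Fin n) : |signs n i| ≤ 1 := by
  unfold signs
  split_ifs <;> simp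

theorem tens_diagonal {S : Finset ℕ} (σ : (a : ℕ) → Fin (d a) → ℝ) :
    tens S (fun a => Matrix.diagonal fun i => (σ a i : ℂ)) =
      Matrix.diagonal fun u : Cfg d S => ((∏ a : S, σ a (u a) : ℝ) : ℂ) := by
  ext u v
  simp only [tens_apply, Matrix.diagonal_apply, Finset.prod_ite_zero, Finset.mem_univ, true_imp_iff,
    funext_iff, Complex.ofReal_prod]

theorem partialTrace_smul_add_smul {S T : Finset ℕ} (c c' : ℂ) (R R' : Op d S) :
    partialTrace T (c • R + c' • R') = c • partialTrace T R + c' • partialTrace T R' := by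
  ext u v
  simp only [partialTrace, Matrix.add_apply, Matrix.smul_apply, smul_eq_mul, Finset.mul_sum,
    Finset.sum_add_distrib]

/-- The operator which correlates the signs of `A` and `B` is deterministic and signalling. -/
theorem signalling_of_transmits {x : QType} (hx : x.NoRepeat) (hd : ∀ a ∈ x.ele, 2 ≤ d a) {A B : ℕ}
    (hA : A ∈ x.inSys) (hB : B ∈ x.outSys) (h : x.Transmits A B) : Signalling d x A B := by
  intro hns
  have hd' : ∀ a ∈ x.ele, 0 < d a := fun a ha => by have := hd a ha; omega
  obtain ⟨hA1, hA2⟩ := QType.mem_inSys.1 hA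
  obtain ⟨hB1, hB2⟩ := QType.mem_outSys.1 hB
  let σ : (a : ℕ) → Fin (d a) → ℝ := fun a i => if a = A ∨ a = B then signs (d a) i else 1
  let t : (a : ℕ) → Matrix (Fin (d a)) (Fin (d a)) ℂ := fun a =>
    Matrix.diagonal fun i => (σ a i : ℂ)
  have ht : IsTest {A, B} t := by
    constructor
    · intro a ha
      have ha' : a = A ∨ a = B := by simpa using ha
      have hda : 2 ≤ d a := by rcases ha' with rfl | rfl <;> exact hd _ ‹_›
      simp only [t, σ, ha', if_true, Matrix.trace_diagonal]
      exact_mod_cast sum_signs hda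
    · intro a ha
      have ha' : ¬(a = A ∨ a = B) := by simpa using ha
      simp [t, σ, ha']
  have hall : x.Allowed {A, B} := by
    refine h _ (fun a ha _ => ?_) (by simp)
    rcases ha with rfl | ha
    · exact .inl rfl
    · rw [Set.mem_singleton_iff.1 ha]
      exact .inr hB2
  have hw := mixWeight_pos hd'
  set w : ℂ := (mixWeight d x : ℂ) with hw_def
  have hw' : w ≠ 0 := by rw [hw_def]; exact_mod_cast hw.ne'
  have hgood : Good x (w • (1 : Op d x.ele) + w • tens x.ele t) :=
    good_add hd' (fun b s hs hb => by rw [map_smul, pair_tens_of_allowed hs ht hb hall, smul_zero])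
      (by rw [Matrix.trace_smul, trace_tens_eq_zero ht hA1 (by simp), smul_zero])
  have hpos : (w • (1 : Op d x.ele) + w • tens x.ele t).PosSemidef := by
    rw [← smul_add]
    refine Matrix.PosSemidef.smul ?_ (by rw [hw_def]; exact_mod_cast hw.le)
    rw [tens_diagonal, ← Matrix.diagonal_one, Matrix.diagonal_add]
    refine Matrix.PosSemidef.diagonal fun u => ?_
    have hle : |∏ a : x.ele, σ a (u a)| ≤ 1 := by
      rw [Finset.abs_prod]
      refine Finset.prod_le_one (fun _ _ => abs_nonneg _) fun a _ => ?_
      simp only [σ]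
      split_ifs
      · exact abs_signs_le _ _
      · simp
    have hnn : 0 ≤ 1 + ∏ a : x.ele, σ a (u a) := by
      have := (abs_le.1 hle).1
      linarith
    have hnn' : (0 : ℂ) ≤ ((1 + ∏ a : x.ele, σ a (u a) : ℝ) : ℂ) := by exact_mod_cast hnn
    simpa using hnn'
  obtain ⟨R', hR'⟩ := hns _ ((mem_detMaps_iff hx hd').2 ⟨hpos, hgood⟩)
  have hT : x.outSys \ {B} ⊆ x.ele := Finset.sdiff_subset.trans Finset.sdiff_subset
  have hA' : A ∈ x.ele \ (x.outSys \ {B}) := by simp [hA1, QType.mem_outSys, hA2]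
  have hcard : 0 < Fintype.card (Cfg d (x.outSys \ {B})) := card_cfg_pos fun a ha => hd' a (hT ha)
  have htT : tens (x.outSys \ {B}) t = 1 := by
    rw [← tens_one]
    refine tens_congr fun a ha => ht.2 a ?_
    simp only [Finset.mem_sdiff, QType.mem_outSys, Finset.mem_singleton] at ha
    rintro (rfl | h)
    · omega
    · exact ha.2 h
  rw [partialTrace_smul_add_smul, ← tens_one, partialTrace_tens hT, partialTrace_tens hT, htT,
    tens_one, tens_one, Matrix.trace_one, tens_diagonal] at hR'
  -- compare the diagonal entries at `0` and at the configuration which differs from it at `A`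
  let u₀ : Cfg d (x.ele \ (x.outSys \ {B})) := fun a => ⟨0, hd' a (Finset.mem_sdiff.1 a.2).1⟩
  let u₁ : Cfg d (x.ele \ (x.outSys \ {B})) := fun a =>
    ⟨if (a : ℕ) = A then 1 else 0, by
      have := hd a (Finset.mem_sdiff.1 a.2).1
      split_ifs <;> omega⟩
  have hid : ∀ u, idTensor A R' u u = R' (u.restrict Finset.sdiff_subset)
      (u.restrict Finset.sdiff_subset) := fun u => by simp [idTensor]
  have hu : (u₁.restrict Finset.sdiff_subset : Cfg d ((x.ele \ (x.outSys \ {B})) \ {A})) =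
      u₀.restrict Finset.sdiff_subset := by
    funext a
    have : (a : ℕ) ≠ A := fun h => (Finset.mem_sdiff.1 a.2).2 (Finset.mem_singleton.2 h)
    simp [u₀, u₁, Cfg.restrict, this]
  have p₀ : ∏ a : ↥(x.ele \ (x.outSys \ {B})), σ a (u₀ a) = 1 := by
    refine Finset.prod_eq_one fun a _ => ?_
    simp [σ, u₀, signs]
  have p₁ : ∏ a : ↥(x.ele \ (x.outSys \ {B})), σ a (u₁ a) = -1 := by
    rw [Fintype.prod_eq_single ⟨A, hA'⟩]
    · simp [σ, u₁, signs]
    · rintro ⟨a, ha⟩ hne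
      have : a ≠ A := fun h => hne (Subtype.ext h)
      simp [σ, u₁, signs, this]
  have h₀ := congrFun (congrFun hR' u₀) u₀
  have h₁ := congrFun (congrFun hR' u₁) u₁
  rw [hid] at h₀ h₁
  rw [hu, ← h₀] at h₁
  simp only [Matrix.add_apply, Matrix.smul_apply, Matrix.one_apply_eq, Matrix.diagonal_apply_eq, p₀,
    p₁, smul_eq_mul] at h₁
  have hc : (Fintype.card (Cfg d (x.outSys \ {B})) : ℂ) ≠ 0 := by exact_mod_cast hcard.ne'
  have : w * (Fintype.card (Cfg d (x.outSys \ {B})) : ℂ) = 0 := by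
    push_cast at h₁
    linear_combination -h₁ / 2
  exact (mul_ne_zero hw' hc) this

namespace QType

theorem noRepeat_bar {x : QType} (hx : x.NoRepeat) : x.bar.NoRepeat :=
  ⟨hx, List.nodup_nil, by simp [triv, ele]⟩

theorem mem_ele_bar {x : QType} {a : ℕ} : a ∈ x.bar.ele ↔ a ∈ x.ele := by
  simp [bar, triv, ele]

end QType

theorem fullSignalling_of_transmits {x : QType} (hx : x.NoRepeat) (hd : ∀ a ∈ x.ele, 0 < d a)
    {A B : ℕ} (hA : A ∈ x.ele) (hB : B ∈ x.outSys) (h : x.Transmits A B) :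
    FullSignalling d x A B := by
  obtain ⟨hB1, hB2⟩ := QType.mem_outSys.1 hB
  refine noSignalling_of_blocks (QType.noRepeat_bar hx) (fun a ha => hd a (QType.mem_ele_bar.1 ha))
    (QType.mem_inSys.2 ⟨QType.mem_ele_bar.2 hB1, ?_⟩)
    (h.blocks_arrow (QType.noRepeat_bar hx) hB1 hA)
  rw [QType.bar, parity_arrow_left hB1, hB2]

/-! ### The signalling structure of a type -/

namespace QType.Meet

variable {x y : QType} {A B : ℕ}

theorem parity_add (h : Meet A B y x) (hA : A ∈ x.inSys) (hB : B ∈ x.outSys) :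
    parity y.word A + parity y.word B = 1 := by
  have h1 := h.parity_ne_iff.2 (by rw [(mem_inSys.1 hA).2, (mem_outSys.1 hB).2]; simp)
  have := parity_lt_two y.word A
  have := parity_lt_two y.word B
  omega

theorem transmits (h : Meet A B y x) (hx : x.NoRepeat) (hA : A ∈ x.inSys) (hB : B ∈ x.outSys)
    (hy : A ∈ y.inSys) : x.Transmits A B := by
  have h1 := h.parity_add hA hB
  have h2 := (mem_inSys.1 hy).2
  exact (h.transmits_and_blocks hx h2 (by omega)).1 (mem_inSys.1 hA).2

theorem blocks (h : Meet A B y x) (hx : x.NoRepeat) (hA : A ∈ x.inSys) (hB : B ∈ x.outSys)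
    (hy : A ∈ y.outSys) : x.Blocks A B := by
  have h1 := h.parity_add hA hB
  have h2 := (mem_outSys.1 hy).2
  exact (h.symm.transmits_and_blocks hx (by omega) h2).2 (mem_outSys.1 hB).2

theorem signalling_iff (h : Meet A B y x) (hx : x.NoRepeat) (hd : ∀ a ∈ x.ele, 2 ≤ d a)
    (hA : A ∈ x.inSys) (hB : B ∈ x.outSys) : Signalling d x A B ↔ parity y.word A = 1 := by
  constructor
  · intro hs
    by_contra hy
    have := parity_lt_two y.word A
    refine hs (noSignalling_of_blocks hx (fun a ha => by have := hd a ha; omega) hA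
      (h.blocks hx hA hB (mem_outSys.2 ⟨h.mem.1, by omega⟩)))
  · intro hy
    exact signalling_of_transmits hx hd hA hB (h.transmits hx hA hB (mem_inSys.2 ⟨h.mem.1, hy⟩))

end QType.Meet

theorem Query.exists_meet (q : Query) : ∃ y, QType.Meet q.src q.dst y q.x := by
  obtain ⟨hA1, hA2⟩ := QType.mem_inSys.1 q.src_mem
  obtain ⟨hB1, hB2⟩ := QType.mem_outSys.1 q.dst_mem
  exact QType.exists_meet q.noRepeat hA1 hB1 (by omega)

theorem Machine.answer_eq_true_iff {q : Query} {y : QType} (hy : QType.Meet q.src q.dst y q.x) :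
    Machine.answer q = true ↔ parity y.word q.src = 1 := by
  obtain ⟨h, hs⟩ := hy.scan_word q.noRepeat
  rw [Machine.answer, hs, decide_eq_true_iff]

end HigherOrder

theorem mainTheorem2 :
    (∀ (d : ℕ → ℕ) (x : HigherOrder.QType), x.NoRepeat → (∀ a ∈ x.ele, 2 ≤ d a) →
      ∀ A ∈ x.inSys, ∀ B ∈ x.outSys,
        (∃! y : HigherOrder.QType, x.IsMinimalFor A B y) ∧
        ∀ y : HigherOrder.QType, x.IsMinimalFor A B y →
          (∀ y' : HigherOrder.QType, y'.SubEq x → {A, B} ⊆ y'.ele → y.SubEq y') ∧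
          (∃ y₁ y₂ : HigherOrder.QType, y = HigherOrder.QType.arrow y₁ y₂ ∧
            ((A ∈ y₁.ele ∧ B ∈ y₂.ele) ∨ (B ∈ y₁.ele ∧ A ∈ y₂.ele))) ∧
          (A ∈ y.inSys →
            HigherOrder.FullSignalling d x A B ∧ HigherOrder.Signalling d x A B) ∧
          (A ∈ y.outSys → HigherOrder.NoSignalling d x A B) ∧
          (∃ s : List HigherOrder.Letter,
            y.word = HigherOrder.Letter.lpar :: (s ++ [HigherOrder.Letter.rpar]) ∧
            (∀ t, HigherOrder.IsSmallestBalanced x.word A B t ↔ t = s) ∧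
            (HigherOrder.Signalling d x A B ↔
              HigherOrder.parity s A = HigherOrder.parity x.word A))) ∧
    (∃ f : HigherOrder.Query → Bool,
      Nonempty (Turing.TM2ComputableInPolyTime HigherOrder.Query.encode
        Computability.encodeBool f) ∧
      ∀ (q : HigherOrder.Query) (d : ℕ → ℕ), (∀ a ∈ q.x.ele, 2 ≤ d a) →
        (f q = true ↔ HigherOrder.Signalling d q.x q.src q.dst)) := by
  refine ⟨fun d x hx hd A hA B hB => ?_, HigherOrder.Machine.answer,
    ⟨HigherOrder.Machine.computable⟩, fun q d hd => ?_⟩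
  · obtain ⟨hA1, hA2⟩ := HigherOrder.QType.mem_inSys.1 hA
    obtain ⟨hB1, hB2⟩ := HigherOrder.QType.mem_outSys.1 hB
    have hd' : ∀ a ∈ x.ele, 0 < d a := fun a ha => by have := hd a ha; omega
    obtain ⟨y, hy⟩ := HigherOrder.QType.exists_meet hx hA1 hB1 (by omega)
    refine ⟨⟨y, hy.isMinimalFor_iff.2 rfl, fun z hz => hy.isMinimalFor_iff.1 hz⟩, ?_⟩
    intro z hz
    obtain rfl := hy.isMinimalFor_iff.1 hz
    refine ⟨fun y' hy' hAB => ?_, hy.splits, fun h => ?_, fun h => ?_, ?_⟩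
    · rw [Finset.insert_subset_iff, Finset.singleton_subset_iff] at hAB
      exact hy.subEq_of_mem hy' hAB.1 hAB.2
    · have ht := hy.transmits hx hA hB h
      exact ⟨HigherOrder.fullSignalling_of_transmits hx hd' hA1 hB ht,
        HigherOrder.signalling_of_transmits hx hd hA hB ht⟩
    · exact HigherOrder.noSignalling_of_blocks hx hd' hA (hy.blocks hx hA hB h)
    · obtain ⟨s, hs, hmin, hpar⟩ := hy.exists_smallest
      exact ⟨s, hs, hmin, by rw [hy.signalling_iff hx hd hA hB, hpar, hA2]⟩
  · obtain ⟨y, hy⟩ := q.exists_meet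
    rw [HigherOrder.Machine.answer_eq_true_iff hy,
      hy.signalling_iff q.noRepeat hd q.src_mem q.dst_mem]
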